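/- **Definitions.** A lattice polytope in $\mathbb{R}^n$ is the convex hull of finitely many points of $\mathbb{Z}^n$. Two lattice polytopes $\nabla\subset\mathbb{R}^n$ and $\nabla'\subset\mathbb{R}^{m}$ are *equivalent*, $\nabla\cong\nabla'$, if there is an affine isomorphism $\mathrm{AffSpan}(\nabla)\to\mathrm{AffSpan}(\nabla')$ mapping $\mathrm{AffSpan}(\nabla)\cap\mathbb{Z}^n$ onto $\mathrm{AffSpan}(\nabla')\cap\mathbb{Z}^{m}$ and $\nabla$ onto $\nabla'$. A positive dimensional lattice polytope is *prime* if it is not equivalent to a product of lattice polytopes of strictly smaller dimension. A lattice polytope $\nabla$ is *compressed* if it has width one with respect to each of its facets: for each facet $F$, $\nabla$ lies between the hyperplane of $\mathrm{AffSpan}(\nabla)$ spanned by $F$ and one of the two neighbouring parallel lattice hyperplanes. A *quiver* $Q$ is a finite directed graph with vertex set $Q_0$ and arrow set $Q_1$, multiple arrows allowed, no loops; $a^-$ and $a^+$ are the tail and head of the arrow $a$. For a weight $\theta\in\mathbb{Z}^{Q_0}$ and $\ell,u\in\mathbb{N}_0^{Q_1}$ put $$\mathcal{A}(Q,\theta)=\Big\{x\in\mathbb{R}^{Q_1}\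 \Big|\ \sum_{a^+=v}x(a)-\sum_{a^-=v}x(a)=\theta(v)\ \ \forall v\in Q_0\Big\},$$ $$\nabla(Q,\theta)=\{x\in\mathcal{A}(Q,\theta)\mid x(a)\ge 0\ \forall a\},\qquad \nabla(Q,\theta,\ell,u)=\{x\in\mathcal{A}(Q,\theta)\mid \ell(a)\le x(a)\le u(a)\ \forall a\}.$$ A *flow polytope* is a lattice polytope equivalent to some $\nabla(Q,\theta,\ell,u)$. The pair $(Q,\theta)$ is *tight* if $Q$ has no oriented cycles and no arrow $a$ satisfies (R) $\nabla(Q,\theta)\subseteq\{x(a)=0\}$ or (C) $\{x\in\mathcal{A}(Q,\theta)\mid x(b)\ge0\ \forall b\neq a\}\subseteq\{x\in\mathcal{A}(Q,\theta)\mid x(a)\ge0\}$. Consider the following three quivers with weights, with a polynomial of degree $1$ in $x,y,z$ attached to each arrow. * I.a: vertices $s,t$ of weights $-1,1$; four arrows $s\to t$ labelled $x,\ y,\ z,\ 1-x-y-z$. * II.c: vertices $r,s,t$ of weights $-1,0,1$; an arrow $r\to t$ labelled $y$; two arrows $r\to s$ labelled $1-y-z,\ z$; two arrows $s\to t$ labelled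 $x,\ 1-x-y$. * I.b: vertices $s,s'$ of weight $-2$ and $t_1,t_2,t_3,t_4$ of weight $1$; arrows $s\to t_i$ labelled $x,\ y,\ 1-z,\ 1-x-y+z$ and arrows $s'\to t_i$ labelled $1-x,\ 1-y,\ z,\ x+y-z$ $(i=1,2,3,4)$. In each case let $\nabla\subset\mathbb{R}^3$ be the set of all points $(x,y,z)$ at which all labels are $\ge 0$; denote the results by $\nabla_{\mathrm{I.a}}$, $\nabla_{\mathrm{II.c}}$, $\nabla_{\mathrm{I.b}}$. **Proposition.** Up to equivalence there are exactly three prime compressed $3$-dimensional flow polytopes: $\nabla_{\mathrm{I.a}}$, $\nabla_{\mathrm{II.c}}$ and $\nabla_{\mathrm{I.b}}$. That is, these three are prime compressed $3$-dimensional flow polytopes, they are pairwise inequivalent, and every prime compressed $3$-dimensional flow polytope is equivalent to one of them. Moreover: 1. each of the three pairs $(Q,\theta)$ above is tight, and the map sending $(x,y,z)$ to the values of the arrow labels at $(x,y,z)$ induces an equivalence $\nabla\cong\nabla(Q,\theta)$; 2. the lattice points are * $\nabla_{\mathrm{I.a}}$ (4 points): $(0,0,0),(1,0,0),(0,1,0),(0,0,1)$;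 * $\nabla_{\mathrm{II.c}}$ (5 points): $(0,0,0),(0,0,1),(1,0,0),(1,0,1),(0,1,0)$; * $\nabla_{\mathrm{I.b}}$ (6 points): $(0,0,0),(1,0,0),(1,0,1),(0,1,0),(0,1,1),(1,1,1)$; 3. $\nabla_{\mathrm{I.a}}$ is the unimodular simplex, i.e. the convex hull of $(0,0,0),(1,0,0),(0,1,0),(0,0,1)$. -/

import Mathlib

namespace FlowPolytope

/-! ### Lattice polytopes in `ℝ^ι` -/

/-- The lattice `ℤ^ι` inside `ℝ^ι`. -/
def lattice (ι : Type*) : Set (ι → ℝ) := {x | ∀ i, ∃ n : ℤ, x i = n}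

/-- A lattice polytope: the convex hull of finitely many lattice points. -/
def IsLatticePolytope {ι : Type*} (P : Set (ι → ℝ)) : Prop :=
  ∃ s : Set (ι → ℝ), s.Finite ∧ s ⊆ lattice ι ∧ P = convexHull ℝ s

/-- The dimension of the affine span. -/
noncomputable def polyDim {ι : Type*} (P : Set (ι → ℝ)) : ℕ :=
  Module.finrank ℝ (vectorSpan ℝ P)

/-- The affine map `f` restricts to an affine isomorphism from the affine span of `P` onto the
affine span of `P'` that maps lattice points onto lattice points and `P` onto `P'`.
(That the affine span of `P` is mapped onto the affine span of `P'` follows from `f '' P = P'`.) -/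
def IsLatticeEquivalence {ι κ : Type*} (f : (ι → ℝ) →ᵃ[ℝ] (κ → ℝ))
    (P : Set (ι → ℝ)) (P' : Set (κ → ℝ)) : Prop :=
  Set.InjOn f (affineSpan ℝ P : Set (ι → ℝ)) ∧
  f '' ((affineSpan ℝ P : Set (ι → ℝ)) ∩ lattice ι)
    = (affineSpan ℝ P' : Set (κ → ℝ)) ∩ lattice κ ∧
  f '' P = P'

/-- Equivalence of lattice polytopes. Every affine map between the affine spans extends to
an affine map between the ambient spaces, so it is enough to consider the latter. -/
def LatticeEquivalent {ι κ : Type*} (P : Set (ι → ℝ)) (P' : Set (κ → ℝ)) : Prop :=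
  ∃ f : (ι → ℝ) →ᵃ[ℝ] (κ → ℝ), IsLatticeEquivalence f P P'

/-- The product `P × P'` in `ℝ^ι × ℝ^κ = ℝ^(ι ⊕ κ)`. -/
def polyProd {ι κ : Type*} (P : Set (ι → ℝ)) (P' : Set (κ → ℝ)) : Set (ι ⊕ κ → ℝ) :=
  {x | (fun i => x (Sum.inl i)) ∈ P ∧ (fun k => x (Sum.inr k)) ∈ P'}

/-- A positive dimensional lattice polytope is prime if it is not equivalent to a product of
lattice polytopes of strictly smaller dimension. -/
def IsPrimePolytope {ι : Type*} (P : Set (ι → ℝ)) : Prop :=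
  IsLatticePolytope P ∧ 0 < polyDim P ∧
  ¬ ∃ (m n : ℕ) (P₁ : Set (Fin m → ℝ)) (P₂ : Set (Fin n → ℝ)),
      IsLatticePolytope P₁ ∧ IsLatticePolytope P₂ ∧
      polyDim P₁ < polyDim P ∧ polyDim P₂ < polyDim P ∧
      LatticeEquivalent P (polyProd P₁ P₂)

/-- A facet: a nonempty (exposed) face of codimension one. -/
def IsFacet {ι : Type*} (P F : Set (ι → ℝ)) : Prop :=
  IsExposed ℝ P F ∧ F.Nonempty ∧ polyDim F + 1 = polyDim P

/-- A lattice polytope is compressed if it has width one with respect to each of its facets `F`: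
there is a primitive integral affine function `h` on the affine span of `P` (it maps the
lattice points of the affine span onto `ℤ`, so its integer level sets are the consecutive
lattice hyperplanes parallel to `F`) that vanishes on `F` and satisfies `0 ≤ h ≤ 1` on `P`. -/
def IsCompressed {ι : Type*} (P : Set (ι → ℝ)) : Prop :=
  IsLatticePolytope P ∧
  ∀ F : Set (ι → ℝ), IsFacet P F →
    ∃ h : (ι → ℝ) →ᵃ[ℝ] ℝ,
      h '' ((affineSpan ℝ P : Set (ι → ℝ)) ∩ lattice ι) = Set.range (fun n : ℤ => (n : ℝ)) ∧
      (∀ x ∈ F, h x = 0) ∧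
      ∀ x ∈ P, 0 ≤ h x ∧ h x ≤ 1

/-! ### Quivers and flow polytopes -/

/-- A directed multigraph without loops, with vertex set `V` and arrow set `A`. -/
structure FlowQuiver (V A : Type*) where
  tail : A → V
  head : A → V
  tail_ne_head : ∀ a, tail a ≠ head a

namespace FlowQuiver

variable {V A : Type*}

/-- There is no oriented cycle. -/
def IsAcyclic (Q : FlowQuiver V A) : Prop :=
  ∀ v, ¬ Relation.TransGen (fun v w => ∃ a, Q.tail a = v ∧ Q.head a = w) v v

variable [DecidableEq V] [Fintype A]

/-- The affine space of all real flows `x` whose net inflow at each vertex `v` is `θ v`. -/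
def flowSpace (Q : FlowQuiver V A) (θ : V → ℤ) : Set (A → ℝ) :=
  {x | ∀ v, (∑ a with Q.head a = v, x a) - (∑ a with Q.tail a = v, x a) = (θ v : ℝ)}

/-- The polytope of flows with lower bounds `l` and upper bounds `u`. -/
def boundedNabla (Q : FlowQuiver V A) (θ : V → ℤ) (l u : A → ℕ) : Set (A → ℝ) :=
  {x | x ∈ Q.flowSpace θ ∧ ∀ a, (l a : ℝ) ≤ x a ∧ x a ≤ (u a : ℝ)}

/-- The polyhedron of nonnegative flows. -/
def nabla (Q : FlowQuiver V A) (θ : V → ℤ) : Set (A → ℝ) :=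
  {x | x ∈ Q.flowSpace θ ∧ ∀ a, 0 ≤ x a}

/-- The arrow `a` is removable for `θ`. -/
def IsRemovable (Q : FlowQuiver V A) (θ : V → ℤ) (a : A) : Prop :=
  Q.nabla θ ⊆ {x | x a = 0}

/-- The arrow `a` is contractible for `θ`. -/
def IsContractible (Q : FlowQuiver V A) (θ : V → ℤ) (a : A) : Prop :=
  {x | x ∈ Q.flowSpace θ ∧ ∀ b, b ≠ a → 0 ≤ x b} ⊆ {x | x ∈ Q.flowSpace θ ∧ 0 ≤ x a}

/-- The quiver is acyclic, and no arrow is removable or contractible. -/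
def IsTight (Q : FlowQuiver V A) (θ : V → ℤ) : Prop :=
  Q.IsAcyclic ∧ ∀ a, ¬ Q.IsRemovable θ a ∧ ¬ Q.IsContractible θ a

end FlowQuiver

/-- A flow polytope: one that is equivalent to the polytope of bounded flows
of some finite quiver (not necessarily acyclic), integer weight and nonnegative integer bounds. -/
def IsFlowPolytope {ι : Type*} (P : Set (ι → ℝ)) : Prop :=
  ∃ (p q : ℕ) (Q : FlowQuiver (Fin p) (Fin q)) (θ : Fin p → ℤ) (l u : Fin q → ℕ),
    LatticeEquivalent P (Q.boundedNabla θ l u)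

/-- Prime compressed three-dimensional flow polytopes. -/
def IsPrimeCompressedFlow3 {ι : Type*} (P : Set (ι → ℝ)) : Prop :=
  IsFlowPolytope P ∧ IsPrimePolytope P ∧ IsCompressed P ∧ polyDim P = 3

/-! ### The three polytopes

In each case: a quiver, a weight, the degree one polynomials attached to the arrows
(in the coordinates `x = p 0`, `y = p 1`, `z = p 2`), the subset of `ℝ³` on which all of them
are nonnegative, and a list of points. -/

/-- Two vertices, four parallel arrows. -/
def quiverIa : FlowQuiver (Fin 2) (Fin 4) where
  tail := ![0, 0, 0, 0]
  head := ![1, 1, 1, 1]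
  tail_ne_head := by decide

def weightIa : Fin 2 → ℤ := ![-1, 1]

def labelIa (p : Fin 3 → ℝ) : Fin 4 → ℝ :=
  ![p 0, p 1, p 2, 1 - p 0 - p 1 - p 2]

def nablaIa : Set (Fin 3 → ℝ) := {p | ∀ a, 0 ≤ labelIa p a}

def pointsIa : Fin 4 → Fin 3 → ℝ :=
  ![![0, 0, 0], ![1, 0, 0], ![0, 1, 0], ![0, 0, 1]]

/-- Three vertices; one arrow `0 → 2`, two arrows `0 → 1`, two arrows `1 → 2`. -/
def quiverIIc : FlowQuiver (Fin 3) (Fin 5) where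
  tail := ![0, 0, 0, 1, 1]
  head := ![2, 1, 1, 2, 2]
  tail_ne_head := by decide

def weightIIc : Fin 3 → ℤ := ![-1, 0, 1]

def labelIIc (p : Fin 3 → ℝ) : Fin 5 → ℝ :=
  ![p 1, 1 - p 1 - p 2, p 2, p 0, 1 - p 0 - p 1]

def nablaIIc : Set (Fin 3 → ℝ) := {p | ∀ a, 0 ≤ labelIIc p a}

def pointsIIc : Fin 5 → Fin 3 → ℝ :=
  ![![0, 0, 0], ![0, 0, 1], ![1, 0, 0], ![1, 0, 1], ![0, 1, 0]]

/-- Two sources `0`, `1` and four sinks `2`, `3`, `4`, `5`; one arrow from each source to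
each sink. -/
def quiverIb : FlowQuiver (Fin 6) (Fin 8) where
  tail := ![0, 0, 0, 0, 1, 1, 1, 1]
  head := ![2, 3, 4, 5, 2, 3, 4, 5]
  tail_ne_head := by decide

def weightIb : Fin 6 → ℤ := ![-2, -2, 1, 1, 1, 1]

def labelIb (p : Fin 3 → ℝ) : Fin 8 → ℝ :=
  ![p 0, p 1, 1 - p 2, 1 - p 0 - p 1 + p 2,
    1 - p 0, 1 - p 1, p 2, p 0 + p 1 - p 2]

def nablaIb : Set (Fin 3 → ℝ) := {p | ∀ a, 0 ≤ labelIb p a}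

def pointsIb : Fin 6 → Fin 3 → ℝ :=
  ![![0, 0, 0], ![1, 0, 0], ![1, 0, 1], ![0, 1, 0], ![0, 1, 1], ![1, 1, 1]]

end FlowPolytope

open FlowPolytope

/-! Width one turns facets into 0/1 coordinates. A flow polytope P is cut out of its affine span by
the bounds on the arrows. Discarding redundant inequalities leaves some that each define a facet,
and compressedness replaces them by integral affine functions h with 0 ≤ h ≤ 1 on P, which are 0 or
1 at every vertex. As P is bounded, their linear parts have no common zero, so three of them are
coordinates on the 3-dimensional affine span (`exists_cubeChart`). In these coordinates P is the
hull of a set s of vertices of the unit cube.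

Two facts restrict s. Each coordinate plane carries a facet, so it contains at least three vertices
of its square of the cube (`IsCubeChart.mem_or_mem`). A cube vertex missing from s is cut off by a
facet function that is negative there and 0 or 1 on s; comparing its values along parallelograms of
cube vertices excludes further configurations. A finite check leaves fifteen sets (`cube_cases`),
which up to unimodular maps are the simplex, the square pyramid, the octahedron, the triangular
prism and the cube; the last two are products. The chart respects lattices because it is integral
and the points of s already generate ℤ³ affinely (`IsCubeChart.latticeEquivalent`).

Conversely, the three polytopes are compressed because every label stays at most 1. They are prime
because the lattice points of a product form a grid with G a b + G a' b' = G a b' + G a' b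
(`exists_grid`): an apex off a plane holding all other lattice points fits into no such relation,
and the octahedron only has the relations between its three diagonals. The numbers 4, 5, 6 of
lattice points tell them apart. -/

namespace FlowPolytope

open Set Filter Topology

/-! ### Facets of polyhedra given by affine inequalities -/

section Facets

variable {E : Type*} [AddCommGroup E] [Module ℝ E]

theorem convex_forall_nonneg {J : Type*} (g : J → E →ᵃ[ℝ] ℝ) :
    Convex ℝ {x | ∀ j, 0 ≤ g j x} := by
  have : {x | ∀ j, 0 ≤ g j x} = ⋂ j, (g j) ⁻¹' Set.Ici 0 := by ext; simp
  rw [this]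
  exact convex_iInter fun j => (convex_Ici 0).affine_preimage (g j)

/-- If each of finitely many nonnegative affine functions is positive somewhere on a convex set,
then they are all positive at a common point. -/
theorem exists_forall_pos_of_convex {J : Type*} {P : Set E} (hP : Convex ℝ P) (hne : P.Nonempty)
    (g : J → E →ᵃ[ℝ] ℝ) (K : Finset J) (h0 : ∀ j ∈ K, ∀ x ∈ P, 0 ≤ g j x)
    (h1 : ∀ j ∈ K, ∃ x ∈ P, 0 < g j x) : ∃ x ∈ P, ∀ j ∈ K, 0 < g j x := by
  classical
  induction K using Finset.induction_on with
  | empty => obtain ⟨x, hx⟩ := hne; exact ⟨x, hx, by simp⟩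
  | insert a s ha ih =>
    obtain ⟨x, hx, hxs⟩ := ih (fun j hj => h0 j (Finset.mem_insert_of_mem hj))
      (fun j hj => h1 j (Finset.mem_insert_of_mem hj))
    obtain ⟨y, hy, hya⟩ := h1 a (Finset.mem_insert_self _ _)
    refine ⟨AffineMap.lineMap x y (1 / 2 : ℝ), ?_, ?_⟩
    · exact hP.lineMap_mem hx hy ⟨by norm_num, by norm_num⟩
    · intro j hj
      have hjx := h0 j hj x hx
      have hjy := h0 j hj y hy
      rw [AffineMap.apply_lineMap, AffineMap.lineMap_apply_module]
      simp only [smul_eq_mul]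
      rcases Finset.mem_insert.1 hj with rfl | hj'
      · linarith
      · linarith [hxs j hj']

theorem eq_zero_of_mem_affineSpan {P : Set E} (g : E →ᵃ[ℝ] ℝ) (h : ∀ x ∈ P, g x = 0) {x : E}
    (hx : x ∈ affineSpan ℝ P) : g x = 0 := by
  refine affineSpan_induction (p := fun x => g x = 0) hx h fun c u v w hu hv hw => ?_
  rw [AffineMap.map_vadd, map_smul, AffineMap.linearMap_vsub, hu, hv, hw]
  simp

/-- Every finite system of affine inequalities contains an irredundant subsystem. -/
theorem exists_irredundant {J : Type*} [Finite J] (A : AffineSubspace ℝ E) (g : J → E →ᵃ[ℝ] ℝ)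
    {P : Set E} (hP : P = {x | x ∈ A ∧ ∀ j, 0 ≤ g j x}) :
    ∃ K : Finset J, P = {x | x ∈ A ∧ ∀ j ∈ K, 0 ≤ g j x} ∧
      ∀ j ∈ K, ∃ x ∈ A, g j x < 0 ∧ ∀ i ∈ K, i ≠ j → 0 ≤ g i x := by
  classical
  have := Fintype.ofFinite J
  obtain ⟨K, hK⟩ := exists_minimal_of_wellFoundedLT
    (fun K : Finset J => P = {x | x ∈ A ∧ ∀ j ∈ K, 0 ≤ g j x}) ⟨Finset.univ, by simpa using hP⟩
  refine ⟨K, hK.prop, fun j hj => ?_⟩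
  have h1 : ¬ P = {x | x ∈ A ∧ ∀ i ∈ K.erase j, 0 ≤ g i x} :=
    hK.not_prop_of_lt (Finset.erase_ssubset hj)
  by_contra! hcon
  apply h1
  ext x
  rw [hK.prop]
  constructor
  · rintro ⟨hx, h⟩
    exact ⟨hx, fun i hi => h i (Finset.mem_of_mem_erase hi)⟩
  · rintro ⟨hx, h⟩
    have hi : ∀ i ∈ K, i ≠ j → 0 ≤ g i x := fun i hi hij => h i (Finset.mem_erase.2 ⟨hij, hi⟩)
    refine ⟨hx, fun i hiK => ?_⟩
    by_cases hij : i = j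
    · subst hij
      by_contra! hlt
      obtain ⟨k, hk, hkj, hk0⟩ := hcon x hx hlt
      exact absurd (hi k hk hkj) (not_le.2 hk0)
    · exact hi i hiK hij

/-- A point of `P ∩ {g = 0}` from which one can move inside `P` in all directions parallel
to `{g = 0}`, together with a point of `P` where `g` is positive. -/
def IsFacetInequality (P : Set E) (g : E →ᵃ[ℝ] ℝ) : Prop :=
  (∀ x ∈ P, 0 ≤ g x) ∧ (∃ p ∈ P, 0 < g p) ∧
    ∃ y ∈ P, g y = 0 ∧ ∀ v ∈ vectorSpan ℝ P, g.linear v = 0 → ∃ ε : ℝ, 0 < ε ∧ ε • v + y ∈ P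

/-- An irredundant inequality `g j` fails at some `x` of the affine span where the others hold. The
segment from `x` to a point where all are positive crosses `g j = 0` where the others are strictly
positive: a relative interior point of the facet. -/
theorem exists_facet_system {J : Type*} [Finite J] (g : J → E →ᵃ[ℝ] ℝ)
    {P : Set E} (hne : P.Nonempty) (hP : P = {x | x ∈ affineSpan ℝ P ∧ ∀ j, 0 ≤ g j x}) :
    ∃ K : Finset J, P = {x | x ∈ affineSpan ℝ P ∧ ∀ j ∈ K, 0 ≤ g j x} ∧
      ∀ j ∈ K, IsFacetInequality P (g j) := by
  obtain ⟨K, hK, hirr⟩ := exists_irredundant (affineSpan ℝ P) g hP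
  refine ⟨K, hK, ?_⟩
  have h0 : ∀ j ∈ K, ∀ x ∈ P, 0 ≤ g j x := fun j hj x hx => by
    rw [hK] at hx; exact hx.2 j hj
  have hconv : Convex ℝ P := by
    rw [hP]
    exact (affineSpan ℝ P).convex.inter (convex_forall_nonneg g)
  -- An inequality of `K` that is nowhere positive on `P` would vanish on the affine span, against
  -- irredundancy.
  obtain ⟨p, hp, hpos⟩ := exists_forall_pos_of_convex hconv hne g K h0 (fun j hj => by
    by_contra! hcon
    obtain ⟨x, hx, hlt, -⟩ := hirr j hj
    exact hlt.ne (eq_zero_of_mem_affineSpan (g j)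
      (fun x hx => le_antisymm (hcon x hx) (h0 j hj x hx)) hx))
  intro j hj
  refine ⟨h0 j hj, ⟨p, hp, hpos j hj⟩, ?_⟩
  obtain ⟨x, hx, hlt, hge⟩ := hirr j hj
  have hpj := hpos j hj
  have hpA : p ∈ affineSpan ℝ P := subset_affineSpan ℝ P hp
  set t : ℝ := - g j x / (g j p - g j x) with ht
  have hden : 0 < g j p - g j x := by linarith
  have ht0 : 0 < t := div_pos (by linarith) hden
  have ht1 : t < 1 := by rw [ht, div_lt_one hden]; linarith
  have hgi : ∀ i, g i (AffineMap.lineMap x p t) = (1 - t) * g i x + t * g i p := fun i => by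
    rw [AffineMap.apply_lineMap, AffineMap.lineMap_apply_module]; simp
  have hyj : g j (AffineMap.lineMap x p t) = 0 := by
    rw [hgi, ht]; field_simp; ring
  have hyi : ∀ i ∈ K, i ≠ j → 0 < g i (AffineMap.lineMap x p t) := fun i hi hij => by
    rw [hgi]
    have := mul_nonneg (sub_nonneg.2 ht1.le) (hge i hi hij)
    have := mul_pos ht0 (hpos i hi)
    linarith
  have hyA : AffineMap.lineMap x p t ∈ affineSpan ℝ P := AffineMap.lineMap_mem t hx hpA
  generalize AffineMap.lineMap x p t = y at hyj hyi hyA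
  have hyP : y ∈ P := by
    rw [hK]
    refine ⟨hyA, fun i hi => ?_⟩
    by_cases hij : i = j
    · rw [hij, hyj]
    · exact (hyi i hi hij).le
  refine ⟨y, hyP, hyj, fun v hv hjv => ?_⟩
  have hev : ∀ᶠ ε : ℝ in 𝓝[>] 0, ∀ i ∈ K, 0 ≤ g i (ε • v + y) := by
    rw [Filter.eventually_all_finset]
    intro i hi
    have hmap : ∀ ε : ℝ, g i (ε • v + y) = ε * (g i).linear v + g i y := fun ε => by
      rw [← vadd_eq_add, AffineMap.map_vadd]; simp
    simp only [hmap]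
    by_cases hij : i = j
    · subst hij
      exact Eventually.of_forall fun ε => by rw [hjv, hyj]; simp
    · have hc : Continuous fun ε : ℝ => ε * (g i).linear v + g i y := by fun_prop
      have h2 : ∀ᶠ ε : ℝ in 𝓝 0, 0 < ε * (g i).linear v + g i y :=
        hc.continuousAt.eventually_const_lt (by simpa using hyi i hi hij)
      exact (h2.filter_mono nhdsWithin_le_nhds).mono fun ε h => h.le
  obtain ⟨ε, hε, hε0⟩ := (hev.and self_mem_nhdsWithin).exists
  refine ⟨ε, hε0, ?_⟩
  rw [hK]
  refine ⟨?_, hε⟩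
  rw [← vadd_eq_add]
  refine AffineSubspace.vadd_mem_of_mem_direction ?_ hyA
  rw [direction_affineSpan]
  exact Submodule.smul_mem _ _ hv

theorem linear_apply_sub (g : E →ᵃ[ℝ] ℝ) (x y : E) : g.linear (x - y) = g x - g y := by
  simpa using g.linearMap_vsub x y

theorem sub_mem_vectorSpan_of_mem_affineSpan {P : Set E} {x y : E} (hx : x ∈ affineSpan ℝ P)
    (hy : y ∈ affineSpan ℝ P) : x - y ∈ vectorSpan ℝ P := by
  rw [← direction_affineSpan]
  exact AffineSubspace.vsub_mem_direction hx hy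

/-- An affine function that vanishes on the facet `P ∩ {g = 0}` is proportional to `g`. -/
theorem IsFacetInequality.mul_eq_mul {P : Set E} {g : E →ᵃ[ℝ] ℝ} (hg : IsFacetInequality P g)
    {k : E →ᵃ[ℝ] ℝ} (hk : ∀ x ∈ P, g x = 0 → k x = 0) {p x : E} (hp : p ∈ P)
    (hx : x ∈ affineSpan ℝ P) : k x * g p = g x * k p := by
  obtain ⟨-, -, y, hy, hgy, hmove⟩ := hg
  have hky := hk y hy hgy
  have key : ∀ v ∈ vectorSpan ℝ P, g.linear v = 0 → k.linear v = 0 := by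
    intro v hv hgv
    obtain ⟨ε, hε, hmem⟩ := hmove v hv hgv
    have h1 : k (ε • v + y) = 0 := by
      apply hk _ hmem
      rw [← vadd_eq_add, AffineMap.map_vadd, map_smul, hgv, hgy]; simp
    rw [← vadd_eq_add, AffineMap.map_vadd, hky] at h1
    simpa [hε.ne'] using h1
  have hyA := subset_affineSpan ℝ P hy
  have hu := sub_mem_vectorSpan_of_mem_affineSpan (subset_affineSpan ℝ P hp) hyA
  have hw := sub_mem_vectorSpan_of_mem_affineSpan hx hyA
  -- The combination is chosen to be annihilated by the linear part of `g`; as `g` and `k` vanish at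
  -- `y`, the linear part of `k` then gives the claim.
  have := key (g p • (x - y) - g x • (p - y))
    (Submodule.sub_mem _ (Submodule.smul_mem _ _ hw) (Submodule.smul_mem _ _ hu))
    (by rw [map_sub, map_smul, map_smul, linear_apply_sub, linear_apply_sub, hgy,
      smul_eq_mul, smul_eq_mul]; ring)
  rw [map_sub, map_smul, map_smul, linear_apply_sub, linear_apply_sub, hky,
    smul_eq_mul, smul_eq_mul] at this
  linarith

end Facets

/-! ### Facets of compressed polytopes -/

section

variable {ι : Type*} [Fintype ι]

theorem isExposed_setOf_eq_zero {P : Set (ι → ℝ)} {g : (ι → ℝ) →ᵃ[ℝ] ℝ}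
    (h0 : ∀ x ∈ P, 0 ≤ g x) {y : ι → ℝ} (hy : y ∈ P) (hgy : g y = 0) :
    IsExposed ℝ P {x ∈ P | g x = 0} := by
  intro _
  refine ⟨LinearMap.toContinuousLinearMap (-g.linear), ?_⟩
  have hlin : ∀ a b, -(g.linear a) ≤ -(g.linear b) ↔ g b ≤ g a := fun a b => by
    have := linear_apply_sub g a b
    rw [map_sub] at this
    constructor <;> intro <;> linarith
  ext x
  simp only [mem_ofPred_eq, LinearMap.coe_toContinuousLinearMap', LinearMap.neg_apply, hlin]
  constructor
  · rintro ⟨hx, hgx⟩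
    exact ⟨hx, fun z hz => by rw [hgx]; exact h0 z hz⟩
  · rintro ⟨hx, h⟩
    exact ⟨hx, le_antisymm (hgy ▸ h y hy) (h0 x hx)⟩

/-- Since all directions parallel to `g = 0` are available at `y`, the direction space of the face
is the kernel of the linear part of `g` on `vectorSpan ℝ P`. That functional is nonzero, being
positive on `p - y`, so its kernel has codimension one. -/
theorem IsFacetInequality.isFacet {P : Set (ι → ℝ)} {g : (ι → ℝ) →ᵃ[ℝ] ℝ}
    (hg : IsFacetInequality P g) : IsFacet P {x ∈ P | g x = 0} := by
  obtain ⟨h0, ⟨p, hp, hgp⟩, y, hy, hgy, hmove⟩ := hg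
  refine ⟨isExposed_setOf_eq_zero h0 hy hgy, ⟨y, hy, hgy⟩, ?_⟩
  have hspan : vectorSpan ℝ {x ∈ P | g x = 0} =
      (LinearMap.ker (g.linear.domRestrict (vectorSpan ℝ P))).map (vectorSpan ℝ P).subtype := by
    apply le_antisymm
    · rw [vectorSpan_def, Submodule.span_le]
      rintro _ ⟨a, ha, b, hb, rfl⟩
      refine ⟨⟨a - b, vsub_mem_vectorSpan ℝ ha.1 hb.1⟩, ?_, rfl⟩
      simp only [SetLike.mem_coe, LinearMap.mem_ker, LinearMap.domRestrict_apply]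
      rw [linear_apply_sub, ha.2, hb.2, sub_zero]
    · rintro _ ⟨⟨v, hv⟩, hgv, rfl⟩
      simp only [SetLike.mem_coe, LinearMap.mem_ker, LinearMap.domRestrict_apply] at hgv
      obtain ⟨ε, hε, hmem⟩ := hmove v hv hgv
      have h1 : g (ε • v + y) = 0 := by
        rw [← vadd_eq_add, AffineMap.map_vadd, map_smul, hgv, hgy]; simp
      have h2 : ε • v ∈ vectorSpan ℝ {x ∈ P | g x = 0} := by
        have := vsub_mem_vectorSpan ℝ (s := {x ∈ P | g x = 0}) (p₁ := ε • v + y) (p₂ := y)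
          ⟨hmem, h1⟩ ⟨hy, hgy⟩
        simpa using this
      simpa [smul_smul, hε.ne'] using Submodule.smul_mem _ ε⁻¹ h2
  unfold polyDim
  rw [hspan, Submodule.finrank_map_subtype_eq]
  apply Module.Dual.finrank_ker_add_one_of_ne_zero
  intro h
  have h1 := DFunLike.congr_fun h ⟨p - y, vsub_mem_vectorSpan ℝ hp hy⟩
  simp only [LinearMap.domRestrict_apply, LinearMap.zero_apply] at h1
  rw [linear_apply_sub, hgy] at h1
  linarith

/-- A compressed polytope given by finitely many inequalities is given by primitive
integral facet inequalities, with respect to which it has width one. -/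
theorem IsCompressed.exists_system {P : Set (ι → ℝ)} (hc : IsCompressed P) (hne : P.Nonempty)
    {J : Type*} [Finite J] (g : J → (ι → ℝ) →ᵃ[ℝ] ℝ)
    (hP : P = {x | x ∈ affineSpan ℝ P ∧ ∀ j, 0 ≤ g j x}) :
    ∃ (K : Finset J) (h : K → (ι → ℝ) →ᵃ[ℝ] ℝ),
      (P = {x | x ∈ affineSpan ℝ P ∧ ∀ j, 0 ≤ h j x}) ∧
      (∀ j, ∀ x ∈ (affineSpan ℝ P : Set (ι → ℝ)) ∩ lattice ι, ∃ n : ℤ, h j x = n) ∧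
      (∀ j, ∀ x ∈ P, 0 ≤ h j x ∧ h j x ≤ 1) ∧
      ∀ j, ∀ k : (ι → ℝ) →ᵃ[ℝ] ℝ, (∀ x ∈ P, h j x = 0 → k x = 0) →
        ∀ x ∈ affineSpan ℝ P, h j x = 0 → k x = 0 := by
  obtain ⟨K, hK, hfac⟩ := exists_facet_system g hne hP
  have hex : ∀ j : K, ∃ h : (ι → ℝ) →ᵃ[ℝ] ℝ,
      h '' ((affineSpan ℝ P : Set (ι → ℝ)) ∩ lattice ι) = Set.range (fun n : ℤ => (n : ℝ)) ∧
      (∀ x ∈ {x ∈ P | g j x = 0}, h x = 0) ∧ ∀ x ∈ P, 0 ≤ h x ∧ h x ≤ 1 :=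
    fun j => hc.2 _ (hfac j j.2).isFacet
  choose h hint hzero hbd using hex
  have hpos : ∀ j : K, ∃ p ∈ P, 0 < g j p ∧ 0 < h j p := by
    intro j
    obtain ⟨p, hp, hgp⟩ := (hfac j j.2).2.1
    refine ⟨p, hp, hgp, lt_of_le_of_ne (hbd j p hp).1 fun h0 => ?_⟩
    -- Primitivity gives `h j` the value 1 somewhere on the span; being proportional to `g j`, it
    -- cannot then vanish at `p`.
    obtain ⟨x, ⟨hx, -⟩, hx1⟩ : (1 : ℝ) ∈ h j '' ((affineSpan ℝ P : Set (ι → ℝ)) ∩ lattice ι) := by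
      rw [hint j]; exact ⟨1, by simp⟩
    have := (hfac j j.2).mul_eq_mul (k := h j) (fun x hx h0 => hzero j x ⟨hx, h0⟩) hp hx
    rw [hx1, ← h0] at this
    linarith
  have hprop : ∀ j : K, ∃ c : ℝ, 0 < c ∧ ∀ x ∈ affineSpan ℝ P, h j x = c * g j x := by
    intro j
    obtain ⟨p, hp, hgp, hhp⟩ := hpos j
    refine ⟨h j p / g j p, div_pos hhp hgp, fun x hx => ?_⟩
    have := (hfac j j.2).mul_eq_mul (k := h j) (fun x hx h0 => hzero j x ⟨hx, h0⟩) hp hx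
    field_simp
    linarith
  refine ⟨K, h, ?_, ?_, hbd, ?_⟩
  · ext x
    rw [hK]
    have hA : affineSpan ℝ {x | x ∈ affineSpan ℝ P ∧ ∀ j ∈ K, 0 ≤ g j x} = affineSpan ℝ P := by
      rw [← hK]
    simp only [mem_ofPred_eq, hA]
    refine and_congr_right fun hx => ?_
    constructor
    · intro hg j
      obtain ⟨c, hc, hcx⟩ := hprop j
      rw [hcx x hx]
      exact mul_nonneg hc.le (hg j j.2)
    · intro hh j hj
      obtain ⟨c, hc, hcx⟩ := hprop ⟨j, hj⟩
      have := hh ⟨j, hj⟩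
      rw [hcx x hx] at this
      exact nonneg_of_mul_nonneg_right this hc
  · intro j x hx
    have : h j x ∈ Set.range (fun n : ℤ => (n : ℝ)) := by rw [← hint j]; exact ⟨x, hx, rfl⟩
    obtain ⟨n, hn⟩ := this
    exact ⟨n, hn.symm⟩
  · intro j k hk x hx hhx
    obtain ⟨c, hc, hcx⟩ := hprop j
    obtain ⟨p, hp, hgp, -⟩ := hpos j
    have hgx : g j x = 0 := by
      have := hcx x hx
      rw [hhx] at this
      simpa [hc.ne'] using this.symm
    have := (hfac j j.2).mul_eq_mul (k := k) (fun x hx h0 => hk x hx (hzero j x ⟨hx, h0⟩)) hp hx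
    rw [hgx, zero_mul] at this
    simpa [hgp.ne'] using this

theorem IsLatticePolytope.eq_zero_of_line {P : Set (ι → ℝ)} (hP : IsLatticePolytope P)
    {p v : ι → ℝ} (h : ∀ t : ℝ, t • v + p ∈ P) : v = 0 := by
  obtain ⟨s, hs, -, rfl⟩ := hP
  obtain ⟨C, hC⟩ := (isBounded_convexHull.2 hs.isBounded).exists_norm_le
  by_contra hv
  have hv' : 0 < ‖v‖ := norm_pos_iff.2 hv
  have h1 := hC _ (h ((C + ‖p‖ + 1) / ‖v‖))
  have h2 : ‖((C + ‖p‖ + 1) / ‖v‖) • v‖ - ‖p‖ ≤ ‖((C + ‖p‖ + 1) / ‖v‖) • v + p‖ := by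
    have := norm_sub_norm_le (((C + ‖p‖ + 1) / ‖v‖) • v) (-p)
    simpa using this
  have hC0 : 0 ≤ C := (norm_nonneg _).trans h1
  rw [norm_smul, Real.norm_of_nonneg (by positivity), div_mul_cancel₀ _ hv'.ne'] at h2
  linarith

end

/-- Finitely many linear forms without common zero contain a system of coordinates. -/
theorem exists_coordinates {V K : Type*} [AddCommGroup V] [Module ℝ V] [FiniteDimensional ℝ V]
    {d : ℕ} (hd : Module.finrank ℝ V = d) (ℓ : K → Module.Dual ℝ V)
    (h : ∀ v, (∀ j, ℓ j v = 0) → v = 0) :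
    ∃ j : Fin d → K, ∀ v, (∀ i, ℓ (j i) v = 0) → v = 0 := by
  obtain ⟨κ, a, -, hsp, hli⟩ := exists_linearIndependent' ℝ ℓ
  -- Without a common zero the forms span the dual space, so a basis of the dual can be selected
  -- among them.
  have htop : Submodule.span ℝ (Set.range ℓ) = ⊤ := by
    rw [← Subspace.dualCoannihilator_dualAnnihilator_eq (W := Submodule.span ℝ (Set.range ℓ))]
    have : (Submodule.span ℝ (Set.range ℓ)).dualCoannihilator = ⊥ := by
      rw [eq_bot_iff]
      intro v hv
      rw [Submodule.mem_dualCoannihilator] at hv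
      exact h v fun j => hv _ (Submodule.subset_span ⟨j, rfl⟩)
    rw [this, Submodule.dualAnnihilator_bot]
  let b := Module.Basis.mk hli (by rw [hsp, htop])
  have : Fintype κ := FiniteDimensional.fintypeBasisIndex b
  have hcard : Fintype.card κ = d := by
    rw [← Module.finrank_eq_card_basis b, Subspace.dual_finrank_eq, hd]
  let e := (Fintype.equivFinOfCardEq hcard).symm
  refine ⟨fun i => a (e i), fun v hv => h v fun j => ?_⟩
  have hmem : ℓ j ∈ Submodule.span ℝ (Set.range (ℓ ∘ a)) := by rw [hsp, htop]; trivial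
  generalize ℓ j = l at hmem
  induction hmem using Submodule.span_induction with
  | mem x hx =>
    obtain ⟨k, rfl⟩ := hx
    have := hv (e.symm k)
    simpa using this
  | zero => rfl
  | add x y _ _ hx hy => simp [hx, hy]
  | smul c x _ hx => simp [hx]

/-! ### Equivalence, products and flow polytopes -/

section Equivalence

variable {ι κ μ : Type*}

theorem IsLatticeEquivalence.image_affineSpan {f : (ι → ℝ) →ᵃ[ℝ] (κ → ℝ)} {P : Set (ι → ℝ)}
    {P' : Set (κ → ℝ)} (hf : IsLatticeEquivalence f P P') :
    f '' (affineSpan ℝ P) = (affineSpan ℝ P' : Set (κ → ℝ)) := by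
  rw [← hf.2.2, ← AffineSubspace.map_span, AffineSubspace.coe_map]

theorem IsLatticeEquivalence.comp {f : (ι → ℝ) →ᵃ[ℝ] (κ → ℝ)} {g : (κ → ℝ) →ᵃ[ℝ] (μ → ℝ)}
    {P : Set (ι → ℝ)} {P' : Set (κ → ℝ)} {P'' : Set (μ → ℝ)} (hg : IsLatticeEquivalence g P' P'')
    (hf : IsLatticeEquivalence f P P') : IsLatticeEquivalence (g.comp f) P P'' := by
  refine ⟨?_, ?_, ?_⟩
  · rw [AffineMap.coe_comp]
    exact hg.1.comp hf.1 fun x hx => hf.image_affineSpan ▸ mem_image_of_mem f hx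
  · rw [AffineMap.coe_comp, image_comp, hf.2.1, hg.2.1]
  · rw [AffineMap.coe_comp, image_comp, hf.2.2, hg.2.2]

theorem LatticeEquivalent.trans {P : Set (ι → ℝ)} {P' : Set (κ → ℝ)} {P'' : Set (μ → ℝ)} :
    LatticeEquivalent P P' → LatticeEquivalent P' P'' → LatticeEquivalent P P'' :=
  fun ⟨f, hf⟩ ⟨g, hg⟩ => ⟨g.comp f, hg.comp hf⟩

theorem IsLatticeEquivalence.image_inter_lattice {f : (ι → ℝ) →ᵃ[ℝ] (κ → ℝ)} {P : Set (ι → ℝ)}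
    {P' : Set (κ → ℝ)} (hf : IsLatticeEquivalence f P P') :
    f '' (P ∩ lattice ι) = P' ∩ lattice κ := by
  have h1 : P ∩ lattice ι = P ∩ ((affineSpan ℝ P : Set (ι → ℝ)) ∩ lattice ι) := by
    rw [← inter_assoc, inter_eq_left.2 (subset_affineSpan ℝ P)]
  have h2 : P' ∩ lattice κ = P' ∩ ((affineSpan ℝ P' : Set (κ → ℝ)) ∩ lattice κ) := by
    rw [← inter_assoc, inter_eq_left.2 (subset_affineSpan ℝ P')]
  rw [h1, h2, hf.1.image_inter (subset_affineSpan ℝ P) inter_subset_left, hf.2.1, hf.2.2]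

theorem LatticeEquivalent.ncard_eq {P : Set (ι → ℝ)} {P' : Set (κ → ℝ)}
    (h : LatticeEquivalent P P') : (P ∩ lattice ι).ncard = (P' ∩ lattice κ).ncard := by
  obtain ⟨f, hf⟩ := h
  rw [← hf.image_inter_lattice]
  exact ((hf.1.mono (inter_subset_left.trans (subset_affineSpan ℝ P))).ncard_image).symm

/-- Injectivity on the affine span makes the linear part injective on its direction: if it kills
`v`, then `v + p` and `p` have the same image. -/
theorem LatticeEquivalent.polyDim_eq {P : Set (ι → ℝ)} {P' : Set (κ → ℝ)}
    (h : LatticeEquivalent P P') : polyDim P = polyDim P' := by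
  obtain ⟨f, hf⟩ := h
  unfold polyDim
  rw [← hf.2.2, ← AffineMap.map_vectorSpan, ← LinearMap.range_domRestrict]
  refine (LinearMap.finrank_range_of_inj ?_).symm
  rw [injective_iff_map_eq_zero]
  rintro ⟨v, hv⟩ h0
  rw [LinearMap.domRestrict_apply] at h0
  rcases P.eq_empty_or_nonempty with rfl | ⟨p, hp⟩
  · rw [vectorSpan_empty] at hv
    exact Subtype.ext ((Submodule.mem_bot ℝ).1 hv)
  have hpA := subset_affineSpan ℝ P hp
  have hvp : v + p ∈ affineSpan ℝ P := by
    rw [← direction_affineSpan] at hv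
    exact AffineSubspace.vadd_mem_of_mem_direction hv hpA
  have h1 : f (v + p) = f p := by
    rw [← vadd_eq_add, AffineMap.map_vadd, h0, zero_vadd]
  simpa using hf.1 hvp hpA h1

theorem IsLatticeEquivalence.of_injective {f : (ι → ℝ) →ᵃ[ℝ] (κ → ℝ)} (hf : Function.Injective f)
    {P : Set (ι → ℝ)} (hP : affineSpan ℝ P = ⊤) (hl : ∀ x, f x ∈ lattice κ ↔ x ∈ lattice ι) :
    IsLatticeEquivalence f P (f '' P) := by
  refine ⟨hf.injOn, ?_, rfl⟩
  rw [← AffineSubspace.map_span, hP]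
  ext y
  constructor
  · rintro ⟨x, ⟨hx, hxl⟩, rfl⟩
    exact ⟨⟨x, hx, rfl⟩, (hl x).2 hxl⟩
  · rintro ⟨⟨x, hx, rfl⟩, hy⟩
    exact ⟨x, ⟨hx, (hl x).1 hy⟩, rfl⟩

end Equivalence

/-! ### Products and their lattice points -/

section Product

variable {ι κ : Type*}

theorem polyProd_eq_preimage (A : Set (ι → ℝ)) (B : Set (κ → ℝ)) :
    polyProd A B = (LinearEquiv.sumArrowLequivProdArrow ι κ ℝ ℝ).symm '' (A ×ˢ B) := by
  ext x
  constructor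
  · rintro ⟨h1, h2⟩
    refine ⟨(fun i => x (Sum.inl i), fun k => x (Sum.inr k)), ⟨h1, h2⟩, ?_⟩
    ext (i | k) <;> rfl
  · rintro ⟨⟨a, b⟩, ⟨h1, h2⟩, rfl⟩
    exact ⟨h1, h2⟩

theorem convexHull_polyProd (A : Set (ι → ℝ)) (B : Set (κ → ℝ)) :
    convexHull ℝ (polyProd A B) = polyProd (convexHull ℝ A) (convexHull ℝ B) := by
  rw [polyProd_eq_preimage, polyProd_eq_preimage, ← convexHull_prod]
  exact ((LinearEquiv.sumArrowLequivProdArrow ι κ ℝ ℝ).symm.toLinearMap.image_convexHull _).symm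

/-- Subadditivity suffices: if both factors have smaller dimension than the product, both have
positive dimension, hence at least two lattice points each. -/
theorem polyDim_polyProd_le [Fintype ι] [Fintype κ] (A : Set (ι → ℝ)) (B : Set (κ → ℝ)) :
    polyDim (polyProd A B) ≤ polyDim A + polyDim B := by
  let e := (LinearEquiv.sumArrowLequivProdArrow ι κ ℝ ℝ).symm.toLinearMap
  have h : vectorSpan ℝ (polyProd A B) ≤
      (vectorSpan ℝ A).map (e ∘ₗ LinearMap.inl ℝ _ _) ⊔
        (vectorSpan ℝ B).map (e ∘ₗ LinearMap.inr ℝ _ _) := by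
    rw [vectorSpan_def, Submodule.span_le]
    rintro _ ⟨x, hx, y, hy, rfl⟩
    refine Submodule.mem_sup.2 ⟨_, ⟨_, vsub_mem_vectorSpan ℝ hx.1 hy.1, rfl⟩,
      _, ⟨_, vsub_mem_vectorSpan ℝ hx.2 hy.2, rfl⟩, ?_⟩
    ext (i | k) <;> simp [e]
  refine (Submodule.finrank_mono h).trans
    ((Submodule.finrank_add_le_finrank_add_finrank _ _).trans ?_)
  exact add_le_add (Submodule.finrank_map_le _ _) (Submodule.finrank_map_le _ _)

theorem exists_ne_lattice_points {P : Set (ι → ℝ)} (hP : IsLatticePolytope P)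
    (h0 : polyDim P ≠ 0) : ∃ a ∈ P ∩ lattice ι, ∃ b ∈ P ∩ lattice ι, a ≠ b := by
  obtain ⟨s, hs, hl, rfl⟩ := hP
  by_contra! hcon
  apply h0
  have hsub : s.Subsingleton := fun a ha b hb =>
    hcon a ⟨subset_convexHull ℝ s ha, hl ha⟩ b ⟨subset_convexHull ℝ s hb, hl hb⟩
  unfold polyDim
  rw [← direction_affineSpan, affineSpan_convexHull, direction_affineSpan,
    vectorSpan_of_subsingleton ℝ hsub, finrank_bot]

/-- The lattice points of a polytope equivalent to a product form a grid of parallelograms. -/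
theorem exists_grid {ι κ : Type} [Fintype ι] [Fintype κ] {μ : Type*} {P : Set (μ → ℝ)}
    {P₁ : Set (ι → ℝ)} {P₂ : Set (κ → ℝ)} (h₁ : IsLatticePolytope P₁) (h₂ : IsLatticePolytope P₂)
    (hd₁ : polyDim P₁ < polyDim P) (hd₂ : polyDim P₂ < polyDim P)
    (h : LatticeEquivalent P (polyProd P₁ P₂)) :
    ∃ (α β : Type) (_ : Nontrivial α) (_ : Nontrivial β) (G : α → β → μ → ℝ),
      (∀ a b, G a b ∈ P ∩ lattice μ) ∧ (∀ x ∈ P ∩ lattice μ, ∃ a b, G a b = x) ∧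
      (∀ a b a' b', G a b = G a' b' → a = a' ∧ b = b') ∧
      ∀ a b a' b', G a b + G a' b' = G a b' + G a' b := by
  have hdim := h.polyDim_eq.le.trans (polyDim_polyProd_le P₁ P₂)
  obtain ⟨a₀, ha₀, a₁, ha₁, ha⟩ := exists_ne_lattice_points h₁ (by omega)
  obtain ⟨b₀, hb₀, b₁, hb₁, hb⟩ := exists_ne_lattice_points h₂ (by omega)
  obtain ⟨f, hf⟩ := h
  have hex : ∀ (a : ↥(P₁ ∩ lattice ι)) (b : ↥(P₂ ∩ lattice κ)), ∃ x ∈ P ∩ lattice μ,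
      f x = Sum.elim (a : ι → ℝ) (b : κ → ℝ) := by
    rintro ⟨a, ha, hal⟩ ⟨b, hb, hbl⟩
    have : Sum.elim a b ∈ polyProd P₁ P₂ ∩ lattice (ι ⊕ κ) :=
      ⟨⟨ha, hb⟩, by rintro (i | k); exacts [hal i, hbl k]⟩
    rwa [← hf.image_inter_lattice] at this
  choose G hG hfG using hex
  have hinj := hf.1
  have hA : ∀ a b, G a b ∈ affineSpan ℝ P := fun a b => subset_affineSpan ℝ P (hG a b).1
  refine ⟨_, _, ⟨⟨a₀, ha₀⟩, ⟨a₁, ha₁⟩, fun h => ha (Subtype.ext_iff.1 h)⟩,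
    ⟨⟨b₀, hb₀⟩, ⟨b₁, hb₁⟩, fun h => hb (Subtype.ext_iff.1 h)⟩, G, hG, ?_, ?_, ?_⟩
  · rintro x hx
    have hfx : f x ∈ polyProd P₁ P₂ ∩ lattice (ι ⊕ κ) :=
      hf.image_inter_lattice ▸ mem_image_of_mem f hx
    refine ⟨⟨_, hfx.1.1, fun i => hfx.2 _⟩, ⟨_, hfx.1.2, fun k => hfx.2 _⟩,
      hinj (hA _ _) (subset_affineSpan ℝ P hx.1) ?_⟩
    rw [hfG]
    ext (i | k) <;> rfl
  · intro a b a' b' hab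
    have := congrArg f hab
    rw [hfG, hfG, Sum.elim_eq_iff] at this
    exact ⟨Subtype.ext this.1, Subtype.ext this.2⟩
  · intro a b a' b'
    -- The fourth corner of the parallelogram lies in the affine span, where `f` is injective, so
    -- the relation may be checked after applying `f`.
    have hmem : (G a b - G a b') + G a' b' ∈ affineSpan ℝ P := by
      rw [← vadd_eq_add]
      exact AffineSubspace.vadd_mem_of_mem_direction
        (AffineSubspace.vsub_mem_direction (hA _ _) (hA _ _)) (hA _ _)
    have : (G a b - G a b') + G a' b' = G a' b := by
      apply hinj hmem (hA _ _)
      rw [← vadd_eq_add, AffineMap.map_vadd, ← vsub_eq_sub, AffineMap.linearMap_vsub]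
      simp only [hfG]
      ext (i | k) <;> simp
    rw [← this]
    abel

end Product

/-! ### Flow polytopes as polyhedra in their affine span -/

section Flow

theorem FlowQuiver.affineSpan_subset_flowSpace {V A : Type*} [DecidableEq V] [Fintype A]
    (Q : FlowQuiver V A) (θ : V → ℤ) {N : Set (A → ℝ)} (hN : N ⊆ Q.flowSpace θ) :
    (affineSpan ℝ N : Set (A → ℝ)) ⊆ Q.flowSpace θ := by
  intro x hx
  refine affineSpan_induction (p := fun x => x ∈ Q.flowSpace θ) hx hN fun c u v w hu hv hw => ?_
  intro i
  have h1 := hu i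
  have h2 := hv i
  have h3 := hw i
  simp only [vsub_eq_sub, vadd_eq_add, Pi.add_apply, Pi.smul_apply, Pi.sub_apply, smul_eq_mul,
    Finset.sum_add_distrib, ← Finset.mul_sum, Finset.sum_sub_distrib]
  linear_combination c * h1 - c * h2 + h3

/-- A flow polytope is cut out of its affine span by finitely many inequalities. -/
theorem IsFlowPolytope.exists_inequalities {ι : Type*} {P : Set (ι → ℝ)} (h : IsFlowPolytope P) :
    ∃ (J : Type) (_ : Finite J) (g : J → (ι → ℝ) →ᵃ[ℝ] ℝ),
      P = {x | x ∈ affineSpan ℝ P ∧ ∀ j, 0 ≤ g j x} := by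
  obtain ⟨p, q, Q, θ, l, u, f, hf⟩ := h
  let c (a : Fin q) : (ι → ℝ) →ᵃ[ℝ] ℝ :=
    (LinearMap.proj (R := ℝ) (φ := fun _ : Fin q => ℝ) a).toAffineMap.comp f
  refine ⟨Fin q ⊕ Fin q, inferInstance, Sum.elim (fun a => c a - AffineMap.const ℝ _ (l a : ℝ))
    (fun a => AffineMap.const ℝ _ (u a : ℝ) - c a), ?_⟩
  have hc : ∀ a x, c a x = f x a := fun a x => rfl
  ext x
  simp only [mem_ofPred_eq, Sum.forall, Sum.elim_inl, Sum.elim_inr, AffineMap.coe_sub,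
    Pi.sub_apply, AffineMap.const_apply, sub_nonneg, hc]
  constructor
  · intro hx
    have : f x ∈ Q.boundedNabla θ l u := hf.2.2 ▸ mem_image_of_mem f hx
    exact ⟨subset_affineSpan ℝ P hx, fun a => (this.2 a).1, fun a => (this.2 a).2⟩
  · rintro ⟨hx, h1, h2⟩
    have hfx : f x ∈ (affineSpan ℝ (Q.boundedNabla θ l u) : Set (Fin q → ℝ)) :=
      hf.image_affineSpan ▸ mem_image_of_mem f hx
    have : f x ∈ Q.boundedNabla θ l u :=
      ⟨Q.affineSpan_subset_flowSpace θ (fun _ hy => hy.1) hfx, fun a => ⟨h1 a, h2 a⟩⟩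
    rw [← hf.2.2] at this
    obtain ⟨y, hy, hxy⟩ := this
    rwa [← hf.1 (subset_affineSpan ℝ P hy) hx hxy]

end Flow

/-! ### Integral affine maps -/

section IntAffine

variable {m n : Type*} [Fintype n]

/-- The affine map `x ↦ M x + b` with integral coefficients. -/
noncomputable def intAffine (M : Matrix m n ℤ) (b : m → ℤ) : (n → ℝ) →ᵃ[ℝ] (m → ℝ) :=
  (M.map (Int.cast : ℤ → ℝ)).mulVecLin.toAffineMap + AffineMap.const ℝ _ (fun i => (b i : ℝ))

theorem intAffine_apply (M : Matrix m n ℤ) (b : m → ℤ) (x : n → ℝ) (i : m) :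
    intAffine M b x i = ∑ j, (M i j : ℝ) * x j + b i := by
  simp [intAffine, Matrix.mulVec, dotProduct]

/-- The real vector with the given integral coordinates. -/
def castVec {n : Type*} (v : n → ℤ) : n → ℝ := fun i => (v i : ℝ)

theorem castVec_injective {n : Type*} : Function.Injective (castVec : (n → ℤ) → n → ℝ) :=
  fun _ _ h => funext fun i => Int.cast_injective (congrFun h i)

theorem castVec_mem_lattice {n : Type*} (v : n → ℤ) : castVec v ∈ lattice n := fun i => ⟨v i, rfl⟩

theorem exists_castVec_eq {n : Type*} {x : n → ℝ} (hx : x ∈ lattice n) : ∃ v, castVec v = x := by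
  choose v hv using hx
  exact ⟨v, funext fun i => (hv i).symm⟩

theorem intAffine_castVec (M : Matrix m n ℤ) (b : m → ℤ) (v : n → ℤ) :
    intAffine M b (castVec v) = castVec (M.mulVec v + b) := by
  ext i
  rw [intAffine_apply]
  simp [castVec, Matrix.mulVec, dotProduct]

theorem intAffine_leftInverse [Fintype m] [DecidableEq n] {M : Matrix m n ℤ} {b : m → ℤ}
    {N : Matrix n m ℤ} {c : n → ℤ} (h : N * M = 1) (hc : N.mulVec b + c = 0) :
    Function.LeftInverse (intAffine N c) (intAffine M b) := by
  intro x
  have h1 : (N.map (Int.cast : ℤ → ℝ)) * (M.map (Int.cast : ℤ → ℝ)) = 1 := by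
    have := congrArg (fun A : Matrix n n ℤ => A.map (Int.castRingHom ℝ)) h
    rwa [Matrix.map_mul, Matrix.map_one _ (map_zero _) (map_one _)] at this
  have h2 : (N.map (Int.cast : ℤ → ℝ)).mulVec (fun i => (b i : ℝ)) + (fun i => (c i : ℝ)) = 0 := by
    ext i
    have := congrFun hc i
    simp only [Pi.add_apply, Matrix.mulVec, dotProduct, Pi.zero_apply] at this
    simp only [Pi.add_apply, Matrix.mulVec, dotProduct, Pi.zero_apply, Matrix.map_apply]
    exact_mod_cast this
  change (N.map _).mulVec ((M.map _).mulVec x + fun i => (b i : ℝ)) + (fun i => (c i : ℝ)) = x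
  rw [Matrix.mulVec_add, Matrix.mulVec_mulVec, h1, Matrix.one_mulVec, add_assoc, h2, add_zero]

/-- An integral left inverse `(N, c)` ensures that only lattice points are sent to lattice points.
-/
theorem isLatticeEquivalence_intAffine [Fintype m] [DecidableEq n] {M : Matrix m n ℤ} {b : m → ℤ}
    {N : Matrix n m ℤ} {c : n → ℤ} (h : N * M = 1) (hc : N.mulVec b + c = 0) {P : Set (n → ℝ)}
    (hP : affineSpan ℝ P = ⊤) :
    IsLatticeEquivalence (intAffine M b) P (intAffine M b '' P) := by
  have hinv := intAffine_leftInverse h hc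
  refine IsLatticeEquivalence.of_injective hinv.injective hP fun x => ⟨fun hx => ?_, fun hx => ?_⟩
  · obtain ⟨v, hv⟩ := exists_castVec_eq hx
    rw [← hinv x, ← hv, intAffine_castVec]
    exact castVec_mem_lattice _
  · obtain ⟨v, rfl⟩ := exists_castVec_eq hx
    rw [intAffine_castVec]
    exact castVec_mem_lattice _

/-- The convex hull of a finite set of integral points. -/
def latticeHull {n : Type*} (s : Finset (n → ℤ)) : Set (n → ℝ) :=
  convexHull ℝ (castVec '' (s : Set (n → ℤ)))

theorem isLatticePolytope_latticeHull {n : Type*} (s : Finset (n → ℤ)) :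
    IsLatticePolytope (latticeHull s) :=
  ⟨_, s.finite_toSet.image _, by rintro _ ⟨v, -, rfl⟩; exact castVec_mem_lattice v, rfl⟩

theorem image_latticeHull [Fintype m] [DecidableEq m] (M : Matrix m n ℤ) (b : m → ℤ)
    (s : Finset (n → ℤ)) :
    intAffine M b '' latticeHull s = latticeHull (s.image fun v => M.mulVec v + b) := by
  unfold latticeHull
  rw [AffineMap.image_convexHull, image_image, Finset.coe_image, image_image]
  simp_rw [intAffine_castVec]

end IntAffine

/-! ### Full-dimensional polytopes and a criterion for compressedness -/

theorem affineSpan_eq_top_of_frame {E : Type*} [AddCommGroup E] [Module ℝ E] {P : Set E}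
    {a b c d : E} (ha : a ∈ P) (hb : b ∈ P) (hc : c ∈ P) (hd : d ∈ P)
    (h : ∀ x, ∃ r s t : ℝ, x = r • (b - a) + s • (c - a) + t • (d - a)) :
    affineSpan ℝ P = ⊤ := by
  have hne : (affineSpan ℝ P : Set E).Nonempty := ⟨a, subset_affineSpan ℝ P ha⟩
  rw [← AffineSubspace.direction_eq_top_iff_of_nonempty hne, direction_affineSpan, eq_top_iff]
  intro x _
  obtain ⟨r, s, t, rfl⟩ := h x
  exact Submodule.add_mem _ (Submodule.add_mem _
    (Submodule.smul_mem _ _ (vsub_mem_vectorSpan ℝ hb ha))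
    (Submodule.smul_mem _ _ (vsub_mem_vectorSpan ℝ hc ha)))
    (Submodule.smul_mem _ _ (vsub_mem_vectorSpan ℝ hd ha))

theorem polyDim_of_affineSpan_eq_top {n : ℕ} {P : Set (Fin n → ℝ)} (h : affineSpan ℝ P = ⊤) :
    polyDim P = n := by
  unfold polyDim
  rw [← direction_affineSpan, h, AffineSubspace.direction_top, finrank_top, Module.finrank_fin_fun]

section

variable {ι : Type*}

/-- A proper exposed face of a full dimensional polyhedron lies in one of the bounding
hyperplanes. -/
theorem exists_eq_zero_of_isExposed {J : Type*} [Finite J] (g : J → (ι → ℝ) →ᵃ[ℝ] ℝ)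
    {F : Set (ι → ℝ)} (hF : IsExposed ℝ {x | ∀ j, 0 ≤ g j x} F) (hne : F.Nonempty)
    (hproper : F ≠ {x | ∀ j, 0 ≤ g j x}) : ∃ j, ∀ x ∈ F, g j x = 0 := by
  have := Fintype.ofFinite J
  by_contra! hcon
  have hFP : F ⊆ {x | ∀ j, 0 ≤ g j x} := hF.subset
  obtain ⟨x, hx, hpos⟩ := exists_forall_pos_of_convex (hF.convex (convex_forall_nonneg g)) hne g
    Finset.univ (fun j _ x hx => hFP hx j) (fun j _ => by
      obtain ⟨x, hx, h⟩ := hcon j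
      exact ⟨x, hx, lt_of_le_of_ne (hFP hx j) h.symm⟩)
  obtain ⟨l, hl⟩ := hF hne
  -- All `g j` are positive at `x`, so a small step in any direction stays in the polyhedron;
  -- maximality of `l` at `x` makes `l` nonpositive everywhere, hence constant.
  have hle : ∀ v, l v ≤ 0 := by
    intro v
    have hev : ∀ᶠ ε : ℝ in 𝓝[>] 0, ∀ j, 0 ≤ g j (ε • v + x) := by
      rw [Filter.eventually_all]
      intro j
      have hmap : ∀ ε : ℝ, g j (ε • v + x) = ε * (g j).linear v + g j x := fun ε => by
        rw [← vadd_eq_add, AffineMap.map_vadd]; simp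
      simp only [hmap]
      have hc : Continuous fun ε : ℝ => ε * (g j).linear v + g j x := by fun_prop
      have h2 : ∀ᶠ ε : ℝ in 𝓝 0, 0 < ε * (g j).linear v + g j x :=
        hc.continuousAt.eventually_const_lt (by simpa using hpos j (Finset.mem_univ j))
      exact (h2.filter_mono nhdsWithin_le_nhds).mono fun ε h => h.le
    obtain ⟨ε, hε, hε0⟩ := (hev.and self_mem_nhdsWithin).exists
    rw [hl] at hx
    have := hx.2 _ hε
    rw [map_add, map_smul, smul_eq_mul] at this
    have h3 : ε * l v ≤ 0 := by linarith
    exact nonpos_of_mul_nonpos_right h3 hε0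
  apply hproper
  rw [hl]
  ext y
  refine ⟨fun h => h.1, fun h => ⟨h, fun z _ => ?_⟩⟩
  have := hle (z - y)
  rw [map_sub] at this
  linarith

/-- A facet is a proper exposed face by its dimension, hence lies in some `g j = 0`. Only the given
inequalities need testing, and they need not be irredundant. -/
theorem isCompressed_of_inequalities {J : Type*} [Finite J] (g : J → (ι → ℝ) →ᵃ[ℝ] ℝ)
    {P : Set (ι → ℝ)} (hP : P = {x | ∀ j, 0 ≤ g j x}) (hl : IsLatticePolytope P)
    (hspan : affineSpan ℝ P = ⊤) (hle : ∀ j, ∀ x ∈ P, g j x ≤ 1)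
    (hint : ∀ j, g j '' lattice ι = Set.range (fun n : ℤ => (n : ℝ))) : IsCompressed P := by
  refine ⟨hl, fun F hF => ?_⟩
  obtain ⟨hexp, hne, hdim⟩ := hF
  have hproper : F ≠ P := by rintro rfl; omega
  have hge : ∀ j, ∀ x ∈ P, 0 ≤ g j x := fun j x hx => by rw [hP] at hx; exact hx j
  rw [hP] at hexp hproper
  obtain ⟨j, hj⟩ := exists_eq_zero_of_isExposed g hexp hne hproper
  refine ⟨g j, ?_, hj, fun x hx => ⟨hge j x hx, hle j x hx⟩⟩
  rw [hspan, ← hint j]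
  simp

end

/-- The `i`-th component of an affine map. -/
noncomputable def component {m n : Type*} (f : (n → ℝ) →ᵃ[ℝ] (m → ℝ)) (i : m) :
    (n → ℝ) →ᵃ[ℝ] ℝ :=
  (LinearMap.proj (R := ℝ) (φ := fun _ : m => ℝ) i).toAffineMap.comp f

theorem component_apply {m n : Type*} (f : (n → ℝ) →ᵃ[ℝ] (m → ℝ)) (i : m) (x : n → ℝ) :
    component f i x = f x i := rfl

/-- An integral affine function that takes the values `0` and `1` at `p` and `q` is
primitive. -/
theorem image_lattice_component_intAffine {m n : Type*} [Fintype n]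
    (M : Matrix m n ℤ) (b : m → ℤ) (i : m)
    (p q : n → ℤ) (hp : (M.mulVec p + b) i = 0) (hq : (M.mulVec q + b) i = 1) :
    component (intAffine M b) i '' lattice n = Set.range (fun n : ℤ => (n : ℝ)) := by
  ext y
  constructor
  · rintro ⟨x, hx, rfl⟩
    obtain ⟨v, rfl⟩ := exists_castVec_eq hx
    rw [component_apply, intAffine_castVec]
    exact ⟨_, rfl⟩
  · rintro ⟨k, rfl⟩
    refine ⟨castVec (p + k • (q - p)), castVec_mem_lattice _, ?_⟩
    rw [component_apply, intAffine_castVec]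
    simp only [castVec, Pi.add_apply] at hp hq ⊢
    have : (M.mulVec (p + k • (q - p))) i + b i = k := by
      rw [Matrix.mulVec_add, Matrix.mulVec_smul, Matrix.mulVec_sub]
      simp only [Pi.add_apply, Pi.smul_apply, Pi.sub_apply, smul_eq_mul]
      linear_combination (1 - k) * hp + k * hq
    rw [this]

/-! ### Primality criteria -/

/-- In a grid containing `p`, a relation `p + q = r + r'` with `r, r' ≠ p` would equate a positive
`i`-th coordinate with zero. -/
theorem isPrimePolytope_of_apex {ι : Type*} {P : Set (ι → ℝ)} (hl : IsLatticePolytope P)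
    (hd : 0 < polyDim P) {i : ι} {p : ι → ℝ} (hp : p ∈ P ∩ lattice ι) (hpi : 0 < p i)
    (h0 : ∀ x ∈ P, 0 ≤ x i) (h : ∀ x ∈ P ∩ lattice ι, x ≠ p → x i = 0) : IsPrimePolytope P := by
  refine ⟨hl, hd, ?_⟩
  rintro ⟨m, n, P₁, P₂, h₁, h₂, hd₁, hd₂, he⟩
  obtain ⟨α, β, _, _, G, hG, hsurj, hinj, hrel⟩ := exists_grid h₁ h₂ hd₁ hd₂ he
  obtain ⟨a, b, hab⟩ := hsurj p hp
  obtain ⟨a', ha'⟩ := exists_ne a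
  obtain ⟨b', hb'⟩ := exists_ne b
  have h1 := congrFun (hrel a b a' b') i
  simp only [Pi.add_apply] at h1
  have h2 := h _ (hG a b') fun e => hb' (hinj _ _ _ _ (e.trans hab.symm)).2
  have h3 := h _ (hG a' b) fun e => ha' (hinj _ _ _ _ (e.trans hab.symm)).1
  have h4 := h0 _ (hG a' b').1
  rw [hab, h2, h3] at h1
  linarith

/-- For the octahedron, with antipodal vertices listed in mirrored positions: opposite corners of
any grid parallelogram are antipodal, so a corner determines the opposite one and the grid is two by
two. -/
theorem isPrimePolytope_of_rev {ι : Type*} {P : Set (ι → ℝ)} (hl : IsLatticePolytope P)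
    (hd : 0 < polyDim P) (pts : Fin 6 → ι → ℝ) (hinj : Function.Injective pts)
    (hpts : Set.range pts = P ∩ lattice ι)
    (h : ∀ i j k l, pts i + pts j = pts k + pts l → i ≠ k → i ≠ l → j = i.rev) :
    IsPrimePolytope P := by
  refine ⟨hl, hd, ?_⟩
  rintro ⟨m, n, P₁, P₂, h₁, h₂, hd₁, hd₂, he⟩
  obtain ⟨α, β, _, _, G, hG, hsurj, hGinj, hrel⟩ := exists_grid h₁ h₂ hd₁ hd₂ he
  have hI : ∀ a b, ∃ i, pts i = G a b := fun a b => by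
    have := hG a b
    rwa [← hpts] at this
  choose I hI using hI
  have hIinj : ∀ a b a' b', I a b = I a' b' → a = a' ∧ b = b' := fun a b a' b' e =>
    hGinj _ _ _ _ (by rw [← hI, ← hI, e])
  have key : ∀ a b a' b', a ≠ a' → b ≠ b' → I a' b' = (I a b).rev := by
    intro a b a' b' ha hb
    refine h (I a b) (I a' b') (I a b') (I a' b) ?_ ?_ ?_
    · simp only [hI, hrel a b a' b']
    · exact fun e => hb (hIinj _ _ _ _ e).2
    · exact fun e => ha (hIinj _ _ _ _ e).1
  obtain ⟨a, a', ha⟩ := exists_pair_ne α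
  obtain ⟨b, b', hb⟩ := exists_pair_ne β
  -- Both `I x b'` and `I a' b'` would be the antipode of `I a b`.
  have hα : ∀ x, x = a ∨ x = a' := fun x => by
    by_contra! hx
    exact hx.2 (hIinj x b' a' b' ((key a b x b' hx.1.symm hb).trans (key a b a' b' ha hb).symm)).1
  have hβ : ∀ y, y = b ∨ y = b' := fun y => by
    by_contra! hy
    exact hy.2 (hIinj a' y a' b' ((key a b a' y ha hy.1.symm).trans (key a b a' b' ha hb).symm)).2
  have hsub : (Finset.univ : Finset (Fin 6)) ⊆ {I a b, I a b', I a' b, I a' b'} := by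
    intro k _
    have : pts k ∈ P ∩ lattice ι := hpts ▸ ⟨k, rfl⟩
    obtain ⟨x, y, hxy⟩ := hsurj _ this
    rw [← hI] at hxy
    rw [← hinj hxy]
    rcases hα x with rfl | rfl <;> rcases hβ y with rfl | rfl <;> simp
  have := (Finset.card_le_card hsub).trans Finset.card_le_four
  simp at this

/-! ### The three polytopes -/

def matrixIa : Matrix (Fin 4) (Fin 3) ℤ := !![1, 0, 0; 0, 1, 0; 0, 0, 1; -1, -1, -1]
def vectorIa : Fin 4 → ℤ := ![0, 0, 0, 1]
def matrixIIc : Matrix (Fin 5) (Fin 3) ℤ :=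
  !![0, 1, 0; 0, -1, -1; 0, 0, 1; 1, 0, 0; -1, -1, 0]
def vectorIIc : Fin 5 → ℤ := ![0, 1, 0, 0, 1]
def matrixIb : Matrix (Fin 8) (Fin 3) ℤ :=
  !![1, 0, 0; 0, 1, 0; 0, 0, -1; -1, -1, 1; -1, 0, 0; 0, -1, 0; 0, 0, 1; 1, 1, -1]
def vectorIb : Fin 8 → ℤ := ![0, 0, 1, 1, 1, 1, 0, 0]

theorem intAffine_Ia (p : Fin 3 → ℝ) : intAffine matrixIa vectorIa p = labelIa p := by
  ext a
  rw [intAffine_apply]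
  fin_cases a <;> simp [matrixIa, vectorIa, labelIa, Fin.sum_univ_succ]; ring

theorem intAffine_IIc (p : Fin 3 → ℝ) : intAffine matrixIIc vectorIIc p = labelIIc p := by
  ext a
  rw [intAffine_apply]
  fin_cases a <;> simp [matrixIIc, vectorIIc, labelIIc, Fin.sum_univ_succ] <;> ring

theorem intAffine_Ib (p : Fin 3 → ℝ) : intAffine matrixIb vectorIb p = labelIb p := by
  ext a
  rw [intAffine_apply]
  fin_cases a <;> simp [matrixIb, vectorIb, labelIb, Fin.sum_univ_succ] <;> ring

theorem mem_nablaIa {p : Fin 3 → ℝ} :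
    p ∈ nablaIa ↔ 0 ≤ p 0 ∧ 0 ≤ p 1 ∧ 0 ≤ p 2 ∧ 0 ≤ 1 - p 0 - p 1 - p 2 := by
  simp [nablaIa, labelIa, Fin.forall_fin_succ]

theorem mem_nablaIIc {p : Fin 3 → ℝ} :
    p ∈ nablaIIc ↔ 0 ≤ p 1 ∧ 0 ≤ 1 - p 1 - p 2 ∧ 0 ≤ p 2 ∧ 0 ≤ p 0 ∧ 0 ≤ 1 - p 0 - p 1 := by
  simp [nablaIIc, labelIIc, Fin.forall_fin_succ]

theorem mem_nablaIb {p : Fin 3 → ℝ} :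
    p ∈ nablaIb ↔ 0 ≤ p 0 ∧ 0 ≤ p 1 ∧ 0 ≤ 1 - p 2 ∧ 0 ≤ 1 - p 0 - p 1 + p 2 ∧ 0 ≤ 1 - p 0 ∧
      0 ≤ 1 - p 1 ∧ 0 ≤ p 2 ∧ 0 ≤ p 0 + p 1 - p 2 := by
  simp [nablaIb, labelIb, Fin.forall_fin_succ]

/-! ### Lattice points of the three polytopes -/

def intPointsIa : Fin 4 → Fin 3 → ℤ :=
  ![![0, 0, 0], ![1, 0, 0], ![0, 1, 0], ![0, 0, 1]]
def intPointsIIc : Fin 5 → Fin 3 → ℤ :=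
  ![![0, 0, 0], ![0, 0, 1], ![1, 0, 0], ![1, 0, 1], ![0, 1, 0]]
def intPointsIb : Fin 6 → Fin 3 → ℤ :=
  ![![0, 0, 0], ![1, 0, 0], ![1, 0, 1], ![0, 1, 0], ![0, 1, 1], ![1, 1, 1]]

theorem castVec_intPointsIa (i : Fin 4) : castVec (intPointsIa i) = pointsIa i := by
  ext j; fin_cases i <;> fin_cases j <;> simp [castVec, intPointsIa, pointsIa]

theorem castVec_intPointsIIc (i : Fin 5) : castVec (intPointsIIc i) = pointsIIc i := by
  ext j; fin_cases i <;> fin_cases j <;> simp [castVec, intPointsIIc, pointsIIc]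

theorem castVec_intPointsIb (i : Fin 6) : castVec (intPointsIb i) = pointsIb i := by
  ext j; fin_cases i <;> fin_cases j <;> simp [castVec, intPointsIb, pointsIb]

theorem injective_pointsIa : Function.Injective pointsIa := by
  have : Function.Injective intPointsIa := by decide
  simpa [Function.comp_def, castVec_intPointsIa] using castVec_injective.comp this

theorem injective_pointsIIc : Function.Injective pointsIIc := by
  have : Function.Injective intPointsIIc := by decide
  simpa [Function.comp_def, castVec_intPointsIIc] using castVec_injective.comp this

theorem injective_pointsIb : Function.Injective pointsIb := by
  have : Function.Injective intPointsIb := by decide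
  simpa [Function.comp_def, castVec_intPointsIb] using castVec_injective.comp this

theorem pointsIa_mem (i : Fin 4) : pointsIa i ∈ nablaIa := by
  rw [mem_nablaIa]; fin_cases i <;> simp [pointsIa]

theorem pointsIIc_mem (i : Fin 5) : pointsIIc i ∈ nablaIIc := by
  rw [mem_nablaIIc]; fin_cases i <;> simp [pointsIIc]

theorem pointsIb_mem (i : Fin 6) : pointsIb i ∈ nablaIb := by
  rw [mem_nablaIb]; fin_cases i <;> simp [pointsIb]

theorem range_pointsIa : Set.range pointsIa = nablaIa ∩ lattice (Fin 3) := by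
  refine Subset.antisymm ?_ ?_
  · rintro _ ⟨i, rfl⟩
    exact ⟨pointsIa_mem i, castVec_intPointsIa i ▸ castVec_mem_lattice _⟩
  · rintro p ⟨hp, hl⟩
    obtain ⟨v, rfl⟩ := exists_castVec_eq hl
    simp only [mem_nablaIa, castVec] at hp
    norm_cast at hp
    have : ∃ i, intPointsIa i = v := by
      have hv : v = ![v 0, v 1, v 2] := by ext j; fin_cases j <;> rfl
      generalize v 0 = a, v 1 = b, v 2 = c at *
      subst hv
      have : a ≤ 1 := by omega
      have : b ≤ 1 := by omega
      have : c ≤ 1 := by omega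
      obtain ⟨_, _, _, _⟩ := hp
      interval_cases a <;> interval_cases b <;> interval_cases c <;> first | omega | decide
    obtain ⟨i, rfl⟩ := this
    exact ⟨i, (castVec_intPointsIa i).symm⟩

theorem range_pointsIIc : Set.range pointsIIc = nablaIIc ∩ lattice (Fin 3) := by
  refine Subset.antisymm ?_ ?_
  · rintro _ ⟨i, rfl⟩
    exact ⟨pointsIIc_mem i, castVec_intPointsIIc i ▸ castVec_mem_lattice _⟩
  · rintro p ⟨hp, hl⟩
    obtain ⟨v, rfl⟩ := exists_castVec_eq hl
    simp only [mem_nablaIIc, castVec] at hp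
    norm_cast at hp
    have : ∃ i, intPointsIIc i = v := by
      have hv : v = ![v 0, v 1, v 2] := by ext j; fin_cases j <;> rfl
      generalize v 0 = a, v 1 = b, v 2 = c at *
      subst hv
      have : a ≤ 1 := by omega
      have : b ≤ 1 := by omega
      have : c ≤ 1 := by omega
      obtain ⟨_, _, _, _, _⟩ := hp
      interval_cases a <;> interval_cases b <;> interval_cases c <;> first | omega | decide
    obtain ⟨i, rfl⟩ := this
    exact ⟨i, (castVec_intPointsIIc i).symm⟩

theorem range_pointsIb : Set.range pointsIb = nablaIb ∩ lattice (Fin 3) := by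
  refine Subset.antisymm ?_ ?_
  · rintro _ ⟨i, rfl⟩
    exact ⟨pointsIb_mem i, castVec_intPointsIb i ▸ castVec_mem_lattice _⟩
  · rintro p ⟨hp, hl⟩
    obtain ⟨v, rfl⟩ := exists_castVec_eq hl
    simp only [mem_nablaIb, castVec] at hp
    norm_cast at hp
    have : ∃ i, intPointsIb i = v := by
      have hv : v = ![v 0, v 1, v 2] := by ext j; fin_cases j <;> rfl
      generalize v 0 = a, v 1 = b, v 2 = c at *
      subst hv
      have : a ≤ 1 := by omega
      have : b ≤ 1 := by omega
      have : c ≤ 1 := by omega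
      obtain ⟨_, _, _, _, _, _, _, _⟩ := hp
      interval_cases a <;> interval_cases b <;> interval_cases c <;> first | omega | decide
    obtain ⟨i, rfl⟩ := this
    exact ⟨i, (castVec_intPointsIb i).symm⟩

/-! ### Vertices, affine spans and compressedness of the three polytopes -/

theorem nablaIa_eq : nablaIa = {x | ∀ j, 0 ≤ component (intAffine matrixIa vectorIa) j x} := by
  simp only [component_apply, intAffine_Ia, nablaIa]

theorem convex_nablaIa : Convex ℝ nablaIa := by
  rw [nablaIa_eq]
  exact convex_forall_nonneg _

theorem nablaIIc_eq : nablaIIc = {x | ∀ j, 0 ≤ component (intAffine matrixIIc vectorIIc) j x} := by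
  simp only [component_apply, intAffine_IIc, nablaIIc]

theorem convex_nablaIIc : Convex ℝ nablaIIc := by
  rw [nablaIIc_eq]
  exact convex_forall_nonneg _

theorem nablaIb_eq : nablaIb = {x | ∀ j, 0 ≤ component (intAffine matrixIb vectorIb) j x} := by
  simp only [component_apply, intAffine_Ib, nablaIb]

theorem convex_nablaIb : Convex ℝ nablaIb := by
  rw [nablaIb_eq]
  exact convex_forall_nonneg _

theorem sum_smul_mem_convexHull {ι : Type*} {k : ℕ} (pts : Fin k → ι → ℝ) (w : Fin k → ℝ)
    (h0 : ∀ i, 0 ≤ w i) (h1 : ∑ i, w i = 1) :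
    ∑ i, w i • pts i ∈ convexHull ℝ (Set.range pts) :=
  (convex_convexHull ℝ _).sum_mem (fun i _ => h0 i) h1
    fun i _ => subset_convexHull ℝ _ (mem_range_self i)

theorem nablaIa_eq_convexHull : nablaIa = convexHull ℝ (Set.range pointsIa) := by
  refine Subset.antisymm (fun p hp => ?_)
    (convexHull_min (by rintro _ ⟨i, rfl⟩; exact pointsIa_mem i) convex_nablaIa)
  rw [mem_nablaIa] at hp
  obtain ⟨_, _, _, _⟩ := hp
  have := sum_smul_mem_convexHull pointsIa ![1 - p 0 - p 1 - p 2, p 0, p 1, p 2]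
    (by simp [Fin.forall_fin_succ]; refine ⟨?_, ?_, ?_, ?_⟩ <;> linarith)
    (by simp [Fin.sum_univ_succ]; ring)
  convert this using 1
  ext j
  fin_cases j <;> simp [Fin.sum_univ_succ, pointsIa]

theorem nablaIIc_eq_convexHull : nablaIIc = convexHull ℝ (Set.range pointsIIc) := by
  refine Subset.antisymm (fun p hp => ?_)
    (convexHull_min (by rintro _ ⟨i, rfl⟩; exact pointsIIc_mem i) convex_nablaIIc)
  rw [mem_nablaIIc] at hp
  obtain ⟨_, _, _, _, _⟩ := hp
  have key : ∀ w : Fin 5 → ℝ, (∀ i, 0 ≤ w i) → ∑ i, w i = 1 → p 0 = w 2 + w 3 → p 1 = w 4 →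
      p 2 = w 1 + w 3 → p ∈ convexHull ℝ (Set.range pointsIIc) := by
    intro w h0 h1 e0 e1 e2
    convert sum_smul_mem_convexHull pointsIIc w h0 h1 using 1
    ext j
    fin_cases j <;> simp [Fin.sum_univ_succ, pointsIIc, e0, e1, e2]
  -- The square base is cut along the diagonal through points 1 and 2, which splits the pyramid into
  -- two tetrahedra.
  rcases le_total (p 0 + p 1 + p 2) 1 with h | h
  · refine key ![1 - p 0 - p 1 - p 2, p 2, p 0, 0, p 1] ?_ ?_ ?_ ?_ ?_
    · simp [Fin.forall_fin_succ]; refine ⟨?_, ?_, ?_, ?_⟩ <;> linarith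
    all_goals simp [Fin.sum_univ_succ]; try ring
  · refine key ![0, 1 - p 0 - p 1, 1 - p 1 - p 2, p 0 + p 1 + p 2 - 1, p 1] ?_ ?_ ?_ ?_ ?_
    · simp [Fin.forall_fin_succ]; refine ⟨?_, ?_, ?_, ?_⟩ <;> linarith
    all_goals simp [Fin.sum_univ_succ]; try ring

theorem nablaIb_eq_convexHull : nablaIb = convexHull ℝ (Set.range pointsIb) := by
  refine Subset.antisymm (fun p hp => ?_)
    (convexHull_min (by rintro _ ⟨i, rfl⟩; exact pointsIb_mem i) convex_nablaIb)
  rw [mem_nablaIb] at hp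
  obtain ⟨_, _, _, _, _, _, _, _⟩ := hp
  have key : ∀ w₀ w₁ w₂ w₃ w₄ w₅ : ℝ, 0 ≤ w₀ → 0 ≤ w₁ → 0 ≤ w₂ → 0 ≤ w₃ → 0 ≤ w₄ → 0 ≤ w₅ →
      w₀ + w₁ + w₂ + w₃ + w₄ + w₅ = 1 → p 0 = w₁ + w₂ + w₅ → p 1 = w₃ + w₄ + w₅ →
      p 2 = w₂ + w₄ + w₅ → p ∈ convexHull ℝ (Set.range pointsIb) := by
    intro w₀ w₁ w₂ w₃ w₄ w₅ h₀ h₁ h₂ h₃ h₄ h₅ h e0 e1 e2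
    convert sum_smul_mem_convexHull pointsIb ![w₀, w₁, w₂, w₃, w₄, w₅]
      (by simp [Fin.forall_fin_succ, *]) (by simp [Fin.sum_univ_succ]; linarith) using 1
    ext j
    fin_cases j <;> simp [Fin.sum_univ_succ, pointsIb, e0, e1, e2] <;> ring
  -- Four tetrahedra around the diagonal from (0,0,0) to (1,1,1); the weights are barycentric
  -- coordinates.
  rcases le_total (p 2) (p 0) with h | h <;> rcases le_total (p 1) (p 2) with h' | h'
  · refine key (1 - p 0) (p 0 - p 2) (p 2 - p 1) 0 0 (p 1)
      ?_ ?_ ?_ ?_ ?_ ?_ ?_ ?_ ?_ ?_ <;> linarith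
  · refine key (1 - p 0 - p 1 + p 2) (p 0 - p 2) 0 (p 1 - p 2) 0 (p 2)
      ?_ ?_ ?_ ?_ ?_ ?_ ?_ ?_ ?_ ?_ <;> linarith
  · refine key (1 - p 2) 0 (p 2 - p 1) 0 (p 2 - p 0) (p 0 + p 1 - p 2)
      ?_ ?_ ?_ ?_ ?_ ?_ ?_ ?_ ?_ ?_ <;> linarith
  · refine key (1 - p 1) 0 0 (p 1 - p 2) (p 2 - p 0) (p 0)
      ?_ ?_ ?_ ?_ ?_ ?_ ?_ ?_ ?_ ?_ <;> linarith

theorem affineSpan_nablaIa : affineSpan ℝ nablaIa = ⊤ := by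
  refine affineSpan_eq_top_of_frame (pointsIa_mem 0) (pointsIa_mem 1) (pointsIa_mem 2)
    (pointsIa_mem 3) fun x => ⟨x 0, x 1, x 2, ?_⟩
  ext j; fin_cases j <;> simp [pointsIa]

theorem affineSpan_nablaIIc : affineSpan ℝ nablaIIc = ⊤ := by
  refine affineSpan_eq_top_of_frame (pointsIIc_mem 0) (pointsIIc_mem 2) (pointsIIc_mem 4)
    (pointsIIc_mem 1) fun x => ⟨x 0, x 1, x 2, ?_⟩
  ext j; fin_cases j <;> simp [pointsIIc]

theorem affineSpan_nablaIb : affineSpan ℝ nablaIb = ⊤ := by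
  -- The third frame vector is (1,0,1), whence the coefficient `x 0 - x 2` of the first.
  refine affineSpan_eq_top_of_frame (pointsIb_mem 0) (pointsIb_mem 1) (pointsIb_mem 3)
    (pointsIb_mem 2) fun x => ⟨x 0 - x 2, x 1, x 2, ?_⟩
  ext j; fin_cases j <;> simp [pointsIb]

theorem isLatticePolytope_nablaIa : IsLatticePolytope nablaIa :=
  ⟨_, finite_range _, range_pointsIa ▸ inter_subset_right, nablaIa_eq_convexHull⟩

theorem isLatticePolytope_nablaIIc : IsLatticePolytope nablaIIc :=
  ⟨_, finite_range _, range_pointsIIc ▸ inter_subset_right, nablaIIc_eq_convexHull⟩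

theorem isLatticePolytope_nablaIb : IsLatticePolytope nablaIb :=
  ⟨_, finite_range _, range_pointsIb ▸ inter_subset_right, nablaIb_eq_convexHull⟩

theorem labelIa_le_one {p : Fin 3 → ℝ} (hp : p ∈ nablaIa) (a : Fin 4) : labelIa p a ≤ 1 := by
  rw [mem_nablaIa] at hp
  obtain ⟨_, _, _, _⟩ := hp
  fin_cases a <;> simp [labelIa] <;> linarith

theorem labelIIc_le_one {p : Fin 3 → ℝ} (hp : p ∈ nablaIIc) (a : Fin 5) : labelIIc p a ≤ 1 := by
  rw [mem_nablaIIc] at hp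
  obtain ⟨_, _, _, _, _⟩ := hp
  fin_cases a <;> simp [labelIIc] <;> linarith

theorem labelIb_le_one {p : Fin 3 → ℝ} (hp : p ∈ nablaIb) (a : Fin 8) : labelIb p a ≤ 1 := by
  rw [mem_nablaIb] at hp
  obtain ⟨_, _, _, _, _, _, _, _⟩ := hp
  fin_cases a <;> simp [labelIb] <;> linarith

theorem isCompressed_nablaIa : IsCompressed nablaIa := by
  refine isCompressed_of_inequalities _ nablaIa_eq isLatticePolytope_nablaIa affineSpan_nablaIa
    (fun j x hx => ?_) fun j => ?_
  · rw [component_apply, intAffine_Ia]; exact labelIa_le_one hx j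
  · have : ∀ j, ∃ k l, (matrixIa.mulVec (intPointsIa k) + vectorIa) j = 0 ∧
        (matrixIa.mulVec (intPointsIa l) + vectorIa) j = 1 := by decide
    obtain ⟨k, l, hk, hl⟩ := this j
    exact image_lattice_component_intAffine _ _ _ _ _ hk hl

theorem isCompressed_nablaIIc : IsCompressed nablaIIc := by
  refine isCompressed_of_inequalities _ nablaIIc_eq isLatticePolytope_nablaIIc affineSpan_nablaIIc
    (fun j x hx => ?_) fun j => ?_
  · rw [component_apply, intAffine_IIc]; exact labelIIc_le_one hx j
  · have : ∀ j, ∃ k l, (matrixIIc.mulVec (intPointsIIc k) + vectorIIc) j = 0 ∧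
        (matrixIIc.mulVec (intPointsIIc l) + vectorIIc) j = 1 := by decide
    obtain ⟨k, l, hk, hl⟩ := this j
    exact image_lattice_component_intAffine _ _ _ _ _ hk hl

theorem isCompressed_nablaIb : IsCompressed nablaIb := by
  refine isCompressed_of_inequalities _ nablaIb_eq isLatticePolytope_nablaIb affineSpan_nablaIb
    (fun j x hx => ?_) fun j => ?_
  · rw [component_apply, intAffine_Ib]; exact labelIb_le_one hx j
  · have : ∀ j, ∃ k l, (matrixIb.mulVec (intPointsIb k) + vectorIb) j = 0 ∧
        (matrixIb.mulVec (intPointsIb l) + vectorIb) j = 1 := by decide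
    obtain ⟨k, l, hk, hl⟩ := this j
    exact image_lattice_component_intAffine _ _ _ _ _ hk hl

/-! ### Primality of the three polytopes -/

theorem isPrimePolytope_nablaIa : IsPrimePolytope nablaIa := by
  refine isPrimePolytope_of_apex isLatticePolytope_nablaIa
    (by rw [polyDim_of_affineSpan_eq_top affineSpan_nablaIa]; norm_num) (i := 0) (p := pointsIa 1)
    (range_pointsIa ▸ mem_range_self 1) (by simp [pointsIa]) (fun x hx => (mem_nablaIa.1 hx).1) ?_
  rw [← range_pointsIa]
  rintro _ ⟨i, rfl⟩ hne
  fin_cases i <;> simp [pointsIa] at hne ⊢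

theorem isPrimePolytope_nablaIIc : IsPrimePolytope nablaIIc := by
  refine isPrimePolytope_of_apex isLatticePolytope_nablaIIc
    (by rw [polyDim_of_affineSpan_eq_top affineSpan_nablaIIc]; norm_num) (i := 1)
    (p := pointsIIc 4) (range_pointsIIc ▸ mem_range_self 4) (by simp [pointsIIc])
    (fun x hx => (mem_nablaIIc.1 hx).1) ?_
  rw [← range_pointsIIc]
  rintro _ ⟨i, rfl⟩ hne
  fin_cases i <;> simp [pointsIIc] at hne ⊢

-- Antipodal vertices sum to (1,1,1) and occupy mirrored positions in the list; the three diagonals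
-- give the only coincidences of sums.
set_option maxRecDepth 20000 in
theorem eq_rev_of_intPointsIb_add_eq : ∀ i j k l : Fin 6,
    (∀ t, intPointsIb i t + intPointsIb j t = intPointsIb k t + intPointsIb l t) →
      i ≠ k → i ≠ l → j = i.rev := by
  decide

theorem isPrimePolytope_nablaIb : IsPrimePolytope nablaIb := by
  refine isPrimePolytope_of_rev isLatticePolytope_nablaIb
    (by rw [polyDim_of_affineSpan_eq_top affineSpan_nablaIb]; norm_num) pointsIb injective_pointsIb
    range_pointsIb fun i j k l h hk hl => eq_rev_of_intPointsIb_add_eq i j k l (fun t => ?_) hk hl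
  have := congrFun h t
  simp only [← castVec_intPointsIb, Pi.add_apply, castVec] at this
  exact_mod_cast this

/-! ### The quivers -/

theorem FlowQuiver.mem_flowSpace {V A : Type*} [DecidableEq V] [Fintype A] (Q : FlowQuiver V A)
    (θ : V → ℤ) (x : A → ℝ) : x ∈ Q.flowSpace θ ↔ ∀ v, (∑ a, if Q.head a = v then x a else 0) -
      (∑ a, if Q.tail a = v then x a else 0) = (θ v : ℝ) := by
  simp only [FlowQuiver.flowSpace, Finset.sum_filter, mem_ofPred_eq]

theorem image_labelIa : intAffine matrixIa vectorIa '' nablaIa = quiverIa.nabla weightIa := by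
  ext x
  simp only [mem_image, intAffine_Ia]
  constructor
  · rintro ⟨p, hp, rfl⟩
    refine ⟨(FlowQuiver.mem_flowSpace _ _ _).2 fun v => ?_, hp⟩
    fin_cases v <;>
      simp [quiverIa, weightIa, labelIa, Fin.sum_univ_succ]
  · rintro ⟨hx, h0⟩
    rw [FlowQuiver.mem_flowSpace] at hx
    have h1 := hx 1
    simp [quiverIa, weightIa, Fin.sum_univ_succ] at h1
    have : labelIa ![x 0, x 1, x 2] = x := by
      ext j; fin_cases j <;> simp [labelIa]; linarith
    exact ⟨_, fun a => by rw [this]; exact h0 a, this⟩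

theorem image_labelIIc :
    intAffine matrixIIc vectorIIc '' nablaIIc = quiverIIc.nabla weightIIc := by
  ext x
  simp only [mem_image, intAffine_IIc]
  constructor
  · rintro ⟨p, hp, rfl⟩
    refine ⟨(FlowQuiver.mem_flowSpace _ _ _).2 fun v => ?_, hp⟩
    fin_cases v <;>
      simp [quiverIIc, weightIIc, labelIIc, Fin.sum_univ_succ] <;> ring
  · rintro ⟨hx, h0⟩
    rw [FlowQuiver.mem_flowSpace] at hx
    have h1 := hx 0
    have h2 := hx 2
    simp [quiverIIc, weightIIc, Fin.sum_univ_succ] at h1 h2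
    have : labelIIc ![x 3, x 0, x 2] = x := by
      ext j; fin_cases j <;> simp [labelIIc] <;> linarith
    exact ⟨_, fun a => by rw [this]; exact h0 a, this⟩

theorem image_labelIb : intAffine matrixIb vectorIb '' nablaIb = quiverIb.nabla weightIb := by
  ext x
  simp only [mem_image, intAffine_Ib]
  constructor
  · rintro ⟨p, hp, rfl⟩
    refine ⟨(FlowQuiver.mem_flowSpace _ _ _).2 fun v => ?_, hp⟩
    fin_cases v <;>
      simp [quiverIb, weightIb, labelIb, Fin.sum_univ_succ] <;> ring
  · rintro ⟨hx, h0⟩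
    rw [FlowQuiver.mem_flowSpace] at hx
    have h1 := hx 0
    have h2 := hx 2
    have h3 := hx 3
    have h4 := hx 4
    have h5 := hx 5
    simp [quiverIb, weightIb, Fin.sum_univ_succ] at h1 h2 h3 h4 h5
    -- The last coordinate is recovered from arrow 2, whose label is `1 - z`.
    have : labelIb ![x 0, x 1, 1 - x 2] = x := by
      ext j; fin_cases j <;> simp [labelIb] <;> linarith
    exact ⟨_, fun a => by rw [this]; exact h0 a, this⟩

theorem isLatticeEquivalence_labelIa :
    IsLatticeEquivalence (intAffine matrixIa vectorIa) nablaIa (quiverIa.nabla weightIa) := by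
  rw [← image_labelIa]
  exact isLatticeEquivalence_intAffine (N := !![1, 0, 0, 0; 0, 1, 0, 0; 0, 0, 1, 0]) (c := 0)
    (by decide) (by decide) affineSpan_nablaIa

theorem isLatticeEquivalence_labelIIc :
    IsLatticeEquivalence (intAffine matrixIIc vectorIIc) nablaIIc (quiverIIc.nabla weightIIc) := by
  rw [← image_labelIIc]
  exact isLatticeEquivalence_intAffine
    (N := !![0, 0, 0, 1, 0; 1, 0, 0, 0, 0; 0, 0, 1, 0, 0]) (c := 0)
    (by decide) (by decide) affineSpan_nablaIIc

theorem isLatticeEquivalence_labelIb :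
    IsLatticeEquivalence (intAffine matrixIb vectorIb) nablaIb (quiverIb.nabla weightIb) := by
  rw [← image_labelIb]
  exact isLatticeEquivalence_intAffine
    (N := !![1, 0, 0, 0, 0, 0, 0, 0; 0, 1, 0, 0, 0, 0, 0, 0; 0, 0, 0, 0, 0, 0, 1, 0]) (c := 0)
    (by decide) (by decide) affineSpan_nablaIb

theorem FlowQuiver.nabla_eq_boundedNabla {V A : Type*} [DecidableEq V] [Fintype A]
    (Q : FlowQuiver V A) (θ : V → ℤ) (h : ∀ x ∈ Q.nabla θ, ∀ a, x a ≤ 1) :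
    Q.nabla θ = Q.boundedNabla θ (fun _ => 0) (fun _ => 1) := by
  ext x
  constructor
  · exact fun hx => ⟨hx.1, fun a => ⟨by simpa using hx.2 a, by simpa using h x hx a⟩⟩
  · exact fun hx => ⟨hx.1, fun a => by simpa using (hx.2 a).1⟩

theorem isPrimeCompressedFlow3_nablaIa : IsPrimeCompressedFlow3 nablaIa := by
  refine ⟨⟨_, _, quiverIa, weightIa, fun _ => 0, fun _ => 1, ?_⟩, isPrimePolytope_nablaIa,
    isCompressed_nablaIa, polyDim_of_affineSpan_eq_top affineSpan_nablaIa⟩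
  rw [← FlowQuiver.nabla_eq_boundedNabla]
  · exact ⟨_, isLatticeEquivalence_labelIa⟩
  · rw [← image_labelIa]
    rintro _ ⟨p, hp, rfl⟩ a
    rw [intAffine_Ia]
    exact labelIa_le_one hp a

theorem isPrimeCompressedFlow3_nablaIIc : IsPrimeCompressedFlow3 nablaIIc := by
  refine ⟨⟨_, _, quiverIIc, weightIIc, fun _ => 0, fun _ => 1, ?_⟩, isPrimePolytope_nablaIIc,
    isCompressed_nablaIIc, polyDim_of_affineSpan_eq_top affineSpan_nablaIIc⟩
  rw [← FlowQuiver.nabla_eq_boundedNabla]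
  · exact ⟨_, isLatticeEquivalence_labelIIc⟩
  · rw [← image_labelIIc]
    rintro _ ⟨p, hp, rfl⟩ a
    rw [intAffine_IIc]
    exact labelIIc_le_one hp a

theorem isPrimeCompressedFlow3_nablaIb : IsPrimeCompressedFlow3 nablaIb := by
  refine ⟨⟨_, _, quiverIb, weightIb, fun _ => 0, fun _ => 1, ?_⟩, isPrimePolytope_nablaIb,
    isCompressed_nablaIb, polyDim_of_affineSpan_eq_top affineSpan_nablaIb⟩
  rw [← FlowQuiver.nabla_eq_boundedNabla]
  · exact ⟨_, isLatticeEquivalence_labelIb⟩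
  · rw [← image_labelIb]
    rintro _ ⟨p, hp, rfl⟩ a
    rw [intAffine_Ib]
    exact labelIb_le_one hp a

/-! ### Tightness -/

theorem FlowQuiver.isAcyclic_of_lt {V A : Type*} [Preorder V] (Q : FlowQuiver V A)
    (h : ∀ a, Q.tail a < Q.head a) : Q.IsAcyclic := by
  have key : ∀ v w, Relation.TransGen (fun v w => ∃ a, Q.tail a = v ∧ Q.head a = w) v w →
      v < w := by
    intro v w hvw
    induction hvw with
    | single h' => obtain ⟨a, rfl, rfl⟩ := h'; exact h a
    | tail _ h' ih => obtain ⟨a, rfl, rfl⟩ := h'; exact ih.trans (h a)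
  exact fun v hv => lt_irrefl v (key v v hv)

/-- A nonnegative flow that is nonzero on `a` refutes removability, a flow negative exactly on `a`
refutes contractibility. Integral witnesses make the conditions decidable. -/
theorem FlowQuiver.isTight_of_witnesses {V A : Type*} [DecidableEq V] [Fintype A] [Preorder V]
    (Q : FlowQuiver V A) (θ : V → ℤ) (h : ∀ a, Q.tail a < Q.head a)
    (hr : ∀ a, ∃ x : A → ℤ, (∀ v, (∑ a with Q.head a = v, x a) - (∑ a with Q.tail a = v, x a) = θ v)
      ∧ (∀ b, 0 ≤ x b) ∧ x a ≠ 0)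
    (hc : ∀ a, ∃ x : A → ℤ, (∀ v, (∑ a with Q.head a = v, x a) - (∑ a with Q.tail a = v, x a) = θ v)
      ∧ (∀ b, b ≠ a → 0 ≤ x b) ∧ x a < 0) : Q.IsTight θ := by
  refine ⟨Q.isAcyclic_of_lt h, fun a => ⟨fun hrem => ?_, fun hcon => ?_⟩⟩
  · obtain ⟨x, hx, h0, hne⟩ := hr a
    have : castVec x ∈ Q.nabla θ :=
      ⟨fun v => by simp only [castVec]; exact_mod_cast hx v, fun b => Int.cast_nonneg (h0 b)⟩
    exact hne (by exact_mod_cast (show ((x a : ℤ) : ℝ) = 0 from hrem this))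
  · obtain ⟨x, hx, h0, hlt⟩ := hc a
    have : castVec x ∈ {x | x ∈ Q.flowSpace θ ∧ ∀ b, b ≠ a → 0 ≤ x b} :=
      ⟨fun v => by simp only [castVec]; exact_mod_cast hx v, fun b hb => Int.cast_nonneg (h0 b hb)⟩
    have h1 : (0 : ℝ) ≤ ((x a : ℤ) : ℝ) := (hcon this).2
    exact absurd (Int.cast_nonneg_iff.1 h1) (not_le.2 hlt)

theorem isTight_Ia : quiverIa.IsTight weightIa := by
  refine quiverIa.isTight_of_witnesses weightIa (by decide) (fun a => ⟨Pi.single a 1, ?_⟩)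
    (fun a => ⟨Pi.single (a + 1) 2 - Pi.single a 1, ?_⟩)
  · revert a; decide
  · revert a; decide

theorem isTight_IIc : quiverIIc.IsTight weightIIc := by
  refine quiverIIc.isTight_of_witnesses weightIIc (by decide)
    (fun a => ⟨![![1, 0, 0, 0, 0], ![0, 1, 0, 1, 0], ![0, 0, 1, 0, 1], ![0, 1, 0, 1, 0],
      ![0, 0, 1, 0, 1]] a, ?_⟩)
    (fun a => ⟨![![-1, 2, 0, 0, 2], ![0, -1, 2, 1, 0], ![0, 2, -1, 1, 0], ![0, 1, 0, -1, 2],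
      ![0, 1, 0, 2, -1]] a, ?_⟩)
  · revert a; decide
  · revert a; decide

theorem isTight_Ib : quiverIb.IsTight weightIb := by
  -- For contractibility, -1 on `a` is balanced by 2 on the other arrow with the same head and by 1
  -- on the other arrows with the same tail.
  refine quiverIb.isTight_of_witnesses weightIb (by decide)
    (fun a => ⟨![![1, 1, 0, 0, 0, 0, 1, 1], ![1, 1, 0, 0, 0, 0, 1, 1], ![0, 0, 1, 1, 1, 1, 0, 0],
      ![0, 0, 1, 1, 1, 1, 0, 0], ![0, 0, 1, 1, 1, 1, 0, 0], ![0, 0, 1, 1, 1, 1, 0, 0],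
      ![1, 1, 0, 0, 0, 0, 1, 1], ![1, 1, 0, 0, 0, 0, 1, 1]] a, ?_⟩)
    (fun a => ⟨![![-1, 1, 1, 1, 2, 0, 0, 0], ![1, -1, 1, 1, 0, 2, 0, 0], ![1, 1, -1, 1, 0, 0, 2, 0],
      ![1, 1, 1, -1, 0, 0, 0, 2], ![2, 0, 0, 0, -1, 1, 1, 1], ![0, 2, 0, 0, 1, -1, 1, 1],
      ![0, 0, 2, 0, 1, 1, -1, 1], ![0, 0, 0, 2, 1, 1, 1, -1]] a, ?_⟩)
  · revert a; decide
  · revert a; decide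

/-! ### Inequivalence -/

theorem ncard_Ia : (nablaIa ∩ lattice (Fin 3)).ncard = 4 := by
  rw [← range_pointsIa, ← Nat.card_coe_set_eq, Nat.card_range_of_injective injective_pointsIa,
    Nat.card_fin]

theorem ncard_IIc : (nablaIIc ∩ lattice (Fin 3)).ncard = 5 := by
  rw [← range_pointsIIc, ← Nat.card_coe_set_eq, Nat.card_range_of_injective injective_pointsIIc,
    Nat.card_fin]

theorem ncard_Ib : (nablaIb ∩ lattice (Fin 3)).ncard = 6 := by
  rw [← range_pointsIb, ← Nat.card_coe_set_eq, Nat.card_range_of_injective injective_pointsIb,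
    Nat.card_fin]

/-! ### Coordinates given by three facets -/

/-- The linear part of `φ` is injective between spaces of equal dimension, so `φ` is bijective on
the affine span. The inverse `ψ` transports facet functions to the coordinate space. -/
theorem exists_affine_section {E : Type*} [AddCommGroup E] [Module ℝ E] {P : Set E} {d : ℕ}
    [FiniteDimensional ℝ E] (hne : P.Nonempty) (φ : E →ᵃ[ℝ] (Fin d → ℝ))
    (hd : Module.finrank ℝ (vectorSpan ℝ P) = d)
    (hinj : ∀ v ∈ vectorSpan ℝ P, φ.linear v = 0 → v = 0) :
    ∃ ψ : (Fin d → ℝ) →ᵃ[ℝ] E, (∀ z, ψ z ∈ affineSpan ℝ P) ∧ (∀ z, φ (ψ z) = z) ∧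
      ∀ x ∈ affineSpan ℝ P, ψ (φ x) = x := by
  obtain ⟨p, hp⟩ := hne
  have hpA := subset_affineSpan ℝ P hp
  let L := φ.linear.domRestrict (vectorSpan ℝ P)
  have hL : Function.Injective L := by
    rw [injective_iff_map_eq_zero]
    rintro ⟨v, hv⟩ h0
    exact Subtype.ext (hinj v hv h0)
  let e := LinearMap.linearEquivOfInjective L hL (by rw [hd, Module.finrank_fin_fun])
  have he : ∀ v : vectorSpan ℝ P, e v = φ.linear v := fun v => rfl
  let M := (vectorSpan ℝ P).subtype ∘ₗ e.symm.toLinearMap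
  let ψ : (Fin d → ℝ) →ᵃ[ℝ] E := M.toAffineMap + AffineMap.const ℝ _ (p - M (φ p))
  have hψ : ∀ z, ψ z = (e.symm (z - φ p) : E) + p := fun z => by
    simp [ψ, M]
    abel
  refine ⟨ψ, fun z => ?_, fun z => ?_, fun x hx => ?_⟩
  · rw [hψ, ← vadd_eq_add]
    refine AffineSubspace.vadd_mem_of_mem_direction ?_ hpA
    rw [direction_affineSpan]
    exact (e.symm (z - φ p)).2
  · rw [hψ, ← vadd_eq_add, AffineMap.map_vadd, ← he, LinearEquiv.apply_symm_apply]
    simp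
  · have h1 : φ x - φ p = e ⟨x - p, sub_mem_vectorSpan_of_mem_affineSpan hx hpA⟩ := by
      rw [he]
      exact (φ.linearMap_vsub x p).symm
    rw [hψ, h1, LinearEquiv.symm_apply_apply]
    simp

/-- Points of `s` off the plane have integral `v i ≥ 1`, so `|k| ≤ C * v i` on `s` for a large `C`.
Both inequalities are affine and pass to the hull, where `x i = 0` forces `k x = 0`. -/
theorem eq_zero_on_face {n : Type*} (s : Finset (n → ℤ)) (i : n) (h0 : ∀ v ∈ s, 0 ≤ v i)
    (k : (n → ℝ) →ᵃ[ℝ] ℝ) (hk : ∀ v ∈ s, v i = 0 → k (castVec v) = 0) {x : n → ℝ}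
    (hx : x ∈ latticeHull s) (hxi : x i = 0) : k x = 0 := by
  obtain ⟨C, hC⟩ := (s.image fun v => |k (castVec v)|).exists_le
  have hle : ∀ v ∈ s, |k (castVec v)| ≤ C * v i := by
    intro v hv
    rcases (h0 v hv).eq_or_lt with h | h
    · rw [hk v hv h.symm, ← h]; simp
    · have h1 := hC _ (Finset.mem_image_of_mem _ hv)
      have h2 : (1 : ℝ) ≤ v i := by exact_mod_cast h
      have h3 := (abs_nonneg _).trans h1
      nlinarith
  have hproj : ∀ y : n → ℝ, component (AffineMap.id ℝ (n → ℝ)) i y = y i := fun y => rfl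
  let g : Fin 2 → (n → ℝ) →ᵃ[ℝ] ℝ := ![C • component (AffineMap.id ℝ _) i - k,
    C • component (AffineMap.id ℝ _) i + k]
  have hsub : latticeHull s ⊆ {x | ∀ j, 0 ≤ g j x} := by
    refine convexHull_min ?_ (convex_forall_nonneg g)
    rintro _ ⟨v, hv, rfl⟩ j
    have := abs_le.1 (hle v hv)
    fin_cases j
    · simpa [g, hproj, castVec] using this.2
    · simp [g, hproj, castVec]; linarith
  have h1 := hsub hx 0
  have h2 := hsub hx 1
  simp [g, hproj, hxi] at h1 h2
  linarith

/-- A vertex of the unit cube that lies in the convex hull of a set of vertices of the cube is one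
of these vertices. -/
theorem mem_of_castVec_mem_latticeHull {n : Type*} [Fintype n] {s : Finset (n → ℤ)}
    (h01 : ∀ v ∈ s, ∀ i, v i = 0 ∨ v i = 1) {q : n → ℤ} (hq : ∀ i, q i = 0 ∨ q i = 1)
    (hmem : castVec q ∈ latticeHull s) : q ∈ s := by
  by_contra hqs
  -- On cube vertices `g` is the Hamming distance to `q` minus one, hence negative only at `q`.
  let M : Matrix (Fin 1) n ℤ := fun _ i => 1 - 2 * q i
  let g : Fin 1 → (n → ℝ) →ᵃ[ℝ] ℝ :=
    component (intAffine M fun _ => ∑ i, q i - 1)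
  have hval : ∀ v : n → ℤ, g 0 (castVec v) = ((∑ i, (v i * (1 - 2 * q i) + q i) - 1 : ℤ) : ℝ) := by
    intro v
    change intAffine M _ (castVec v) 0 = _
    rw [intAffine_castVec]
    change ((_ : ℤ) : ℝ) = _
    congr 1
    simp only [Pi.add_apply, Matrix.mulVec, dotProduct, M, Finset.sum_add_distrib, mul_comm]
    ring
  have hsub : latticeHull s ⊆ {x | ∀ j, 0 ≤ g j x} := by
    refine convexHull_min ?_ (convex_forall_nonneg g)
    rintro _ ⟨v, hv, rfl⟩ j
    rw [Subsingleton.elim j 0, hval]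
    have hterm : ∀ i, 0 ≤ v i * (1 - 2 * q i) + q i := fun i => by
      rcases h01 v hv i with h | h <;> rcases hq i with h' | h' <;> simp [h, h']
    obtain ⟨i, hi⟩ : ∃ i, v i ≠ q i := by
      by_contra! hcon
      exact hqs (funext hcon ▸ hv)
    have h1 : 1 ≤ v i * (1 - 2 * q i) + q i := by
      rcases h01 v hv i with h | h <;> rcases hq i with h' | h' <;> simp [h, h'] at hi ⊢
    have h2 := Finset.single_le_sum (fun i _ => hterm i) (Finset.mem_univ i)
    have : 0 ≤ ∑ i, (v i * (1 - 2 * q i) + q i) - 1 := by omega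
    exact_mod_cast this
  have h0 := hsub hmem 0
  rw [hval, Finset.sum_eq_zero fun i _ => by rcases hq i with h | h <;> simp [h]] at h0
  norm_num at h0

/-- A `0/1`-polytope together with the properties inherited from a compressed polytope `P` when
three of its facets are used as coordinate planes. -/
structure IsCubeChart {n : ℕ} (P : Set (Fin n → ℝ)) (φ : (Fin n → ℝ) →ᵃ[ℝ] (Fin 3 → ℝ))
    (s : Finset (Fin 3 → ℤ)) : Prop where
  injOn : Set.InjOn φ (affineSpan ℝ P)
  image_eq : φ '' P = latticeHull s
  zero_or_one : ∀ v ∈ s, ∀ i, v i = 0 ∨ v i = 1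
  mem_lattice : ∀ x ∈ (affineSpan ℝ P : Set (Fin n → ℝ)) ∩ lattice (Fin n), φ x ∈ lattice (Fin 3)
  exists_lift : ∀ v ∈ s, ∃ x ∈ (affineSpan ℝ P : Set (Fin n → ℝ)) ∩ lattice (Fin n), φ x = castVec v
  -- The points of `s` in the plane `x i = 0` affinely span it, since the plane carries a facet.
  facet : ∀ i, ∀ k : (Fin 3 → ℝ) →ᵃ[ℝ] ℝ, (∀ v ∈ s, v i = 0 → k (castVec v) = 0) →
    ∀ x, x i = 0 → k x = 0
  separation : ∀ q, q ∉ latticeHull s →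
    ∃ h : (Fin 3 → ℝ) →ᵃ[ℝ] ℝ, h q < 0 ∧ ∀ v ∈ s, h (castVec v) = 0 ∨ h (castVec v) = 1

theorem eq_zero_or_one_of_int {r : ℝ} (hint : ∃ n : ℤ, r = n) (h0 : 0 ≤ r) (h1 : r ≤ 1) :
    r = 0 ∨ r = 1 := by
  obtain ⟨n, rfl⟩ := hint
  have h0' : 0 ≤ n := by exact_mod_cast h0
  have h1' : n ≤ 1 := by exact_mod_cast h1
  have : n = 0 ∨ n = 1 := by omega
  exact_mod_cast this

/-- Three facet functions with independent linear parts serve as coordinates; integrality and width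
one put the generating lattice points at cube vertices. The remaining facet functions, read through
the inverse chart, provide the separation property. -/
theorem exists_cubeChart {n : ℕ} {P : Set (Fin n → ℝ)} (hf : IsFlowPolytope P)
    (hc : IsCompressed P) (hd : polyDim P = 3) : ∃ φ s, IsCubeChart P φ s := by
  have hl := hc.1
  have hne : P.Nonempty := by
    rw [Set.nonempty_iff_ne_empty]
    rintro rfl
    rw [polyDim, vectorSpan_empty, finrank_bot] at hd
    omega
  obtain ⟨J, _, g, hP⟩ := hf.exists_inequalities
  obtain ⟨K, h, hPh, hint, hbd, hfac⟩ := hc.exists_system hne g hP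
  obtain ⟨j, hj⟩ := exists_coordinates (V := vectorSpan ℝ P) hd
    (fun i : K => (h i).linear.domRestrict (vectorSpan ℝ P)) (by
      rintro ⟨v, hv⟩ h0
      obtain ⟨p, hp⟩ := hne
      -- A direction killed by all facet functions would give a line inside the bounded set `P`.
      refine Subtype.ext (hl.eq_zero_of_line (p := p) fun t => ?_)
      change t • v + p ∈ P
      rw [hPh]
      refine ⟨?_, fun i => ?_⟩
      · rw [← vadd_eq_add]
        refine AffineSubspace.vadd_mem_of_mem_direction ?_ (subset_affineSpan ℝ P hp)
        rw [direction_affineSpan]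
        exact Submodule.smul_mem _ _ hv
      · have : (h i).linear v = 0 := h0 i
        rw [← vadd_eq_add, AffineMap.map_vadd, map_smul, this]
        simpa using (hbd i p hp).1)
  let φ : (Fin n → ℝ) →ᵃ[ℝ] (Fin 3 → ℝ) := AffineMap.pi fun i => h (j i)
  have hφ : ∀ x i, φ x i = h (j i) x := fun x i => rfl
  obtain ⟨ψ, hψA, hφψ, hψφ⟩ := exists_affine_section hne φ hd (fun v hv h0 => by
    have := hj ⟨v, hv⟩ fun i => congrFun h0 i
    exact Subtype.ext_iff.1 this)
  have hsub := subset_affineSpan ℝ P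
  obtain ⟨t, ht, htl, htP⟩ := hl
  have htsub : t ⊆ P := htP ▸ subset_convexHull ℝ t
  have hlat : ∀ x ∈ (affineSpan ℝ P : Set (Fin n → ℝ)) ∩ lattice (Fin n), φ x ∈ lattice (Fin 3) :=
    fun x hx i => hint (j i) x hx
  let s : Finset (Fin 3 → ℤ) := ((ht.image φ).preimage castVec_injective.injOn).toFinset
  have hs : castVec '' (s : Set (Fin 3 → ℤ)) = φ '' t := by
    rw [Set.Finite.coe_toFinset]
    refine image_preimage_eq_of_subset ?_
    rintro _ ⟨x, hx, rfl⟩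
    obtain ⟨v, hv⟩ := exists_castVec_eq (hlat x ⟨hsub (htsub hx), htl hx⟩)
    exact ⟨v, hv⟩
  have hlift : ∀ v ∈ s, ∃ x ∈ t, φ x = castVec v := fun v hv => by
    have := mem_image_of_mem castVec (Finset.mem_coe.2 hv)
    rwa [hs] at this
  have himage : φ '' P = latticeHull s := by
    rw [latticeHull, hs, ← AffineMap.image_convexHull, ← htP]
  have hval : ∀ i, ∀ x ∈ t, h i x = 0 ∨ h i x = 1 := fun i x hx =>
    eq_zero_or_one_of_int (hint i x ⟨hsub (htsub hx), htl hx⟩) (hbd i x (htsub hx)).1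
      (hbd i x (htsub hx)).2
  have h01 : ∀ v ∈ s, ∀ i, v i = 0 ∨ v i = 1 := by
    intro v hv i
    obtain ⟨x, hx, hxv⟩ := hlift v hv
    have h1 := hval (j i) x hx
    rw [← hφ, hxv] at h1
    simp only [castVec] at h1
    exact_mod_cast h1
  refine ⟨φ, s, ?_, himage, h01, hlat, ?_, ?_, ?_⟩
  · intro x hx y hy hxy
    rw [← hψφ x hx, hxy, hψφ y hy]
  · intro v hv
    obtain ⟨x, hx, hxv⟩ := hlift v hv
    exact ⟨x, ⟨hsub (htsub hx), htl hx⟩, hxv⟩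
  · intro i k hk x hxi
    -- The pullback of `k` vanishes on the facet, hence on the hyperplane of the affine span that
    -- carries it.
    have := hfac (j i) (k.comp φ) (fun y hy hy0 => ?_) (ψ x) (hψA x) ?_
    · simpa [hφψ] using this
    · exact eq_zero_on_face s i (fun v hv => by rcases h01 v hv i with h | h <;> simp [h]) k hk
        (himage ▸ mem_image_of_mem φ hy) hy0
    · rw [← hφ, hφψ, hxi]
  · intro q hq
    have hqP : ψ q ∉ P := fun hmem => hq (by
      rw [← himage]
      exact ⟨_, hmem, hφψ q⟩)
    obtain ⟨i, hi⟩ : ∃ i, h i (ψ q) < 0 := by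
      by_contra! hcon
      apply hqP
      rw [hPh]
      exact ⟨hψA q, hcon⟩
    refine ⟨(h i).comp ψ, hi, fun v hv => ?_⟩
    obtain ⟨x, hx, hxv⟩ := hlift v hv
    have : ψ (castVec v) = x := by rw [← hxv, hψφ x (hsub (htsub hx))]
    simpa [this] using hval i x hx

/-! ### Classification of the cube charts -/

/-- The vertices of the unit cube; the coordinates of the `j`-th one are the binary digits
of `j`. -/
def cubeVertex : Fin 8 → Fin 3 → ℤ :=
  ![![0, 0, 0], ![1, 0, 0], ![0, 1, 0], ![1, 1, 0], ![0, 0, 1], ![1, 0, 1], ![0, 1, 1], ![1, 1, 1]]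

theorem exists_cubeVertex_eq {v : Fin 3 → ℤ} (hv : ∀ i, v i = 0 ∨ v i = 1) :
    ∃ j, cubeVertex j = v := by
  have h : v = ![v 0, v 1, v 2] := by ext j; fin_cases j <;> rfl
  rw [h]
  rcases hv 0 with h0 | h0 <;> rcases hv 1 with h1 | h1 <;> rcases hv 2 with h2 | h2 <;>
    rw [h0, h1, h2] <;> decide

theorem cubeVertex_zero_or_one : ∀ j i, cubeVertex j i = 0 ∨ cubeVertex j i = 1 := by decide

/-- For any two vertices of a square face of the cube there is an affine function that does
not vanish at the first one and vanishes at the two other vertices of the square. -/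
theorem exists_affine_on_square : ∀ (i : Fin 3) (a b : Fin 8), a ≠ b → cubeVertex a i = 0 →
    cubeVertex b i = 0 → ∃ m ∈ ([![1, 0, 0], ![0, 1, 0], ![0, 0, 1], ![1, 1, 0], ![1, 0, 1],
      ![0, 1, 1], ![1, -1, 0], ![1, 0, -1], ![0, 1, -1]] : List (Fin 3 → ℤ)),
    ∃ d ∈ ([0, -1] : List ℤ), m ⬝ᵥ cubeVertex a + d ≠ 0 ∧
      ∀ j, cubeVertex j i = 0 → m ⬝ᵥ cubeVertex j + d ≠ 0 → j = a ∨ j = b := by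
  decide

theorem exists_coefficients (k : (Fin 3 → ℝ) →ᵃ[ℝ] ℝ) :
    ∃ α β γ δ : ℝ, ∀ x, k x = δ + α * x 0 + β * x 1 + γ * x 2 := by
  refine ⟨k.linear (Pi.single 0 1), k.linear (Pi.single 1 1), k.linear (Pi.single 2 1), k 0,
    fun x => ?_⟩
  have h1 : k x = k.linear x + k 0 := by
    have := k.map_vadd 0 x
    simpa using this
  rw [h1, LinearMap.pi_apply_eq_sum_univ k.linear x]
  have h2 : ∀ i : Fin 3, (fun j => if i = j then (1 : ℝ) else 0) = Pi.single i 1 := fun i => by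
    ext j; simp [Pi.single_apply, eq_comm]
  simp only [h2, Fin.sum_univ_three, smul_eq_mul]
  ring

section

variable {n : ℕ} {P : Set (Fin n → ℝ)} {φ : (Fin n → ℝ) →ᵃ[ℝ] (Fin 3 → ℝ)}
  {s : Finset (Fin 3 → ℤ)}

/-- Each of the three coordinate facets contains at least three of the four vertices of its
square. -/
theorem IsCubeChart.mem_or_mem (h : IsCubeChart P φ s) (i : Fin 3) (a b : Fin 8) (hab : a ≠ b)
    (ha : cubeVertex a i = 0) (hb : cubeVertex b i = 0) : cubeVertex a ∈ s ∨ cubeVertex b ∈ s := by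
  obtain ⟨m, -, d, -, hne, hm⟩ := exists_affine_on_square i a b hab ha hb
  -- With both vertices missing, the function would vanish at every point of `s` in the square,
  -- hence on its plane, but it does not vanish at vertex `a`.
  by_contra! hcon
  let k := component (intAffine (Matrix.of fun _ : Fin 1 => m) fun _ => d) 0
  have hk : ∀ v : Fin 3 → ℤ, k (castVec v) = ((m ⬝ᵥ v + d : ℤ) : ℝ) := fun v => by
    change intAffine (Matrix.of fun _ : Fin 1 => m) (fun _ => d) (castVec v) 0 = _
    rw [intAffine_castVec]
    rfl
  have := h.facet i k (fun v hv hvi => ?_) (castVec (cubeVertex a)) (by simp [castVec, ha])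
  · rw [hk] at this
    exact hne (by exact_mod_cast this)
  · obtain ⟨j, rfl⟩ := exists_cubeVertex_eq (h.zero_or_one v hv)
    rw [hk]
    by_contra hne'
    rcases hm j hvi (by exact_mod_cast hne') with rfl | rfl
    · exact hcon.1 hv
    · exact hcon.2 hv

/-- A cube vertex outside `s` is outside the hull, so a facet function cuts it off; the four numbers
are its coefficients. -/
theorem IsCubeChart.exists_separating (h : IsCubeChart P φ s) {a : Fin 8} (ha : cubeVertex a ∉ s) :
    ∃ α β γ δ : ℝ,
      δ + α * cubeVertex a 0 + β * cubeVertex a 1 + γ * cubeVertex a 2 < 0 ∧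
      ∀ j, cubeVertex j ∈ s →
        δ + α * cubeVertex j 0 + β * cubeVertex j 1 + γ * cubeVertex j 2 = 0 ∨
        δ + α * cubeVertex j 0 + β * cubeVertex j 1 + γ * cubeVertex j 2 = 1 := by
  obtain ⟨k, hneg, hk⟩ := h.separation (castVec (cubeVertex a)) fun hmem =>
    ha (mem_of_castVec_mem_latticeHull h.zero_or_one (cubeVertex_zero_or_one a) hmem)
  obtain ⟨α, β, γ, δ, hcoef⟩ := exists_coefficients k
  refine ⟨α, β, γ, δ, by simpa [hcoef, castVec] using hneg, fun j hj => ?_⟩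
  simpa [hcoef, castVec] using hk _ hj

/-- Let fⱼ be the value of the separating function at vertex j. If f₃ = f₁ + f₂ - f₀ < 0, then f₀ =
1 and f₁ = f₂ = 0, so f₇ = f₃ + f₄ - f₀ < 0, a contradiction. The other two cases are symmetric. -/
theorem IsCubeChart.mem_of_tripod (h : IsCubeChart P φ s) (h0 : cubeVertex 0 ∈ s)
    (h1 : cubeVertex 1 ∈ s) (h2 : cubeVertex 2 ∈ s) (h4 : cubeVertex 4 ∈ s)
    (h7 : cubeVertex 7 ∈ s) : cubeVertex 3 ∈ s ∧ cubeVertex 5 ∈ s ∧ cubeVertex 6 ∈ s := by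
  refine ⟨?_, ?_, ?_⟩
  all_goals
    by_contra hn
    obtain ⟨α, β, γ, δ, hneg, hval⟩ := h.exists_separating hn
    have e0 := hval 0 h0
    have e1 := hval 1 h1
    have e2 := hval 2 h2
    have e4 := hval 4 h4
    have e7 := hval 7 h7
    simp [cubeVertex] at hneg e0 e1 e2 e4 e7
    rcases e0 with e0 | e0 <;> rcases e1 with e1 | e1 <;> rcases e2 with e2 | e2 <;>
      rcases e4 with e4 | e4 <;> rcases e7 with e7 | e7 <;> linarith

/-- From f₇ = f₃ + f₅ - f₁ < 0 follow f₁ = 1 and f₃ = 0; likewise f₂ = 1. Then f₃ = f₁ + f₂ - f₀ ≥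
1, a contradiction. -/
theorem IsCubeChart.mem_seven (h : IsCubeChart P φ s) (h0 : cubeVertex 0 ∈ s)
    (h1 : cubeVertex 1 ∈ s) (h2 : cubeVertex 2 ∈ s) (h3 : cubeVertex 3 ∈ s)
    (h4 : cubeVertex 4 ∈ s) (h5 : cubeVertex 5 ∈ s) (h6 : cubeVertex 6 ∈ s) :
    cubeVertex 7 ∈ s := by
  by_contra hn
  obtain ⟨α, β, γ, δ, hneg, hval⟩ := h.exists_separating hn
  have e0 := hval 0 h0
  have e1 := hval 1 h1
  have e2 := hval 2 h2
  have e3 := hval 3 h3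
  have e4 := hval 4 h4
  have e5 := hval 5 h5
  have e6 := hval 6 h6
  simp [cubeVertex] at hneg e0 e1 e2 e3 e4 e5 e6
  have e3 : 0 ≤ δ + α + β := by rcases e3 with e | e <;> linarith
  have e5 : 0 ≤ δ + α + γ := by rcases e5 with e | e <;> linarith
  have e6 : 0 ≤ δ + β + γ := by rcases e6 with e | e <;> linarith
  rcases e0 with e0 | e0 <;> rcases e1 with e1 | e1 <;> rcases e2 with e2 | e2 <;>
    rcases e4 with e4 | e4 <;> linarith

/-- From f₀ = f₁ + f₂ - f₃ = f₁ + f₄ - f₅ < 0 follow f₃ = f₅ = 1 and f₁ = 0, so f₇ = f₃ + f₅ - f₁ =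
2. -/
theorem IsCubeChart.mem_zero (h : IsCubeChart P φ s) (h1 : cubeVertex 1 ∈ s)
    (h2 : cubeVertex 2 ∈ s) (h3 : cubeVertex 3 ∈ s) (h4 : cubeVertex 4 ∈ s)
    (h5 : cubeVertex 5 ∈ s) (h7 : cubeVertex 7 ∈ s) :
    cubeVertex 0 ∈ s := by
  by_contra hn
  obtain ⟨α, β, γ, δ, hneg, hval⟩ := h.exists_separating hn
  have e1 := hval 1 h1
  have e2 := hval 2 h2
  have e3 := hval 3 h3
  have e4 := hval 4 h4
  have e5 := hval 5 h5
  have e7 := hval 7 h7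
  simp [cubeVertex] at hneg e1 e2 e3 e4 e5 e7
  have e5 : δ + α + γ ≤ 1 := by rcases e5 with e | e <;> linarith
  have e7 : δ + α + β + γ ≤ 1 := by rcases e7 with e | e <;> linarith
  rcases e1 with e1 | e1 <;> rcases e2 with e2 | e2 <;> rcases e4 with e4 | e4 <;>
    rcases e3 with e3 | e3 <;> linarith

/-- For c = 4: f₄ = f₀ + f₅ - f₁ = f₀ + f₆ - f₂ < 0 gives f₀ = 0 and f₁ = f₂ = 1, so f₃ = f₁ + f₂ -
f₀ = 2. -/
theorem IsCubeChart.mem_of_prism (h : IsCubeChart P φ s) {a b c : Fin 8}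
    (hc : (a = 1 ∧ b = 2 ∧ c = 4) ∨ (a = 1 ∧ b = 4 ∧ c = 2) ∨ (a = 2 ∧ b = 4 ∧ c = 1))
    (h0 : cubeVertex 0 ∈ s) (h1 : cubeVertex a ∈ s) (h2 : cubeVertex b ∈ s)
    (h3 : cubeVertex 3 ∈ s) (h5 : cubeVertex 5 ∈ s) (h6 : cubeVertex 6 ∈ s) :
    cubeVertex c ∈ s := by
  by_contra hn
  obtain ⟨α, β, γ, δ, hneg, hval⟩ := h.exists_separating hn
  have e0 := hval 0 h0
  have e1 := hval a h1
  have e2 := hval b h2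
  have e3 := hval 3 h3
  have e5 := hval 5 h5
  have e6 := hval 6 h6
  rcases hc with ⟨rfl, rfl, rfl⟩ | ⟨rfl, rfl, rfl⟩ | ⟨rfl, rfl, rfl⟩
  all_goals
    simp [cubeVertex] at hneg e0 e1 e2 e3 e5 e6
    rcases e0 with e0 | e0 <;> rcases e1 with e1 | e1 <;> rcases e2 with e2 | e2 <;>
      rcases e3 with e3 | e3 <;> rcases e5 with e5 | e5 <;> rcases e6 with e6 | e6 <;> linarith

/-- Here bⱼ records whether vertex j belongs to s. The first fifteen clauses allow at most one
missing vertex in each coordinate square; the other eight come from separation. -/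
theorem cube_cases : ∀ b₀ b₁ b₂ b₃ b₄ b₅ b₆ b₇ : Bool,
    [b₀ || b₁, b₀ || b₂, b₀ || b₃, b₀ || b₄, b₀ || b₅, b₀ || b₆, b₁ || b₂, b₁ || b₃, b₁ || b₄,
      b₁ || b₅, b₂ || b₃, b₂ || b₄, b₂ || b₆, b₄ || b₅, b₄ || b₆,
      !(b₀ && b₁ && b₂ && b₄ && b₇) || b₃, !(b₀ && b₁ && b₂ && b₄ && b₇) || b₅,
      !(b₀ && b₁ && b₂ && b₄ && b₇) || b₆, !(b₀ && b₁ && b₂ && b₃ && b₄ && b₅ && b₆) || b₇,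
      !(b₁ && b₂ && b₃ && b₄ && b₅ && b₆ && b₇) || b₀, !(b₀ && b₁ && b₂ && b₃ && b₅ && b₆) || b₄,
      !(b₀ && b₁ && b₄ && b₅ && b₃ && b₆) || b₂,
      !(b₀ && b₂ && b₄ && b₆ && b₃ && b₅) || b₁].all id →
    [b₀, b₁, b₂, b₃, b₄, b₅, b₆, b₇] ∈ [
      [false, true, true, true, true, true, true, false],
      [true, false, true, true, true, true, false, false],
      [true, false, true, true, true, true, false, true],
      [true, true, false, true, true, false, true, false],
      [true, true, false, true, true, false, true, true],
      [true, true, true, false, false, true, true, false],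
      [true, true, true, false, false, true, true, true],
      [true, true, true, false, true, false, false, false],
      [true, true, true, false, true, false, true, false],
      [true, true, true, false, true, true, false, false],
      [true, true, true, false, true, true, true, false],
      [true, true, true, true, true, false, false, false],
      [true, true, true, true, true, false, true, false],
      [true, true, true, true, true, true, false, false],
      [true, true, true, true, true, true, true, true]] := by
  decide

/-- A set of integral points that generates the affine lattice `ℤ^n`. -/
def SpansLattice {n : Type*} (s : Finset (n → ℤ)) : Prop :=
  ∀ L : Set (n → ℤ), (∀ u ∈ L, ∀ v ∈ L, ∀ w ∈ L, ∀ k : ℤ, u + k • (v - w) ∈ L) →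
    (s : Set (n → ℤ)) ⊆ L → L = Set.univ

/-- The second alternative in `h3` serves the octahedron, which lacks (0,0,1) but has it as a
difference of vertices. -/
theorem spansLattice_of_frame {s : Finset (Fin 3 → ℤ)} (h0 : ![0, 0, 0] ∈ s)
    (h1 : ![1, 0, 0] ∈ s) (h2 : ![0, 1, 0] ∈ s)
    (h3 : ![0, 0, 1] ∈ s ∨ ![1, 0, 0] ∈ s ∧ ![1, 0, 1] ∈ s) : SpansLattice s := by
  intro L hL hs
  have h3 : ![0, 0, 1] ∈ L := by
    rcases h3 with h | ⟨h, h'⟩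
    · exact hs h
    · simpa using hL _ (hs h0) _ (hs h') _ (hs h) 1
  refine eq_univ_of_forall fun v => ?_
  have := hL _ (hL _ (hL _ (hs h0) _ (hs h1) _ (hs h0) (v 0)) _ (hs h2) _ (hs h0) (v 1)) _ h3 _
    (hs h0) (v 2)
  convert this
  ext j; fin_cases j <;> simp

/-- A priori the lattice of the affine span could map to a proper sublattice of ℤ³. But its image is
closed under integral affine combinations and contains `s'`, which generates ℤ³. -/
theorem IsCubeChart.latticeEquivalent (h : IsCubeChart P φ s) {s' : Finset (Fin 3 → ℤ)}
    (hspan : SpansLattice s') (M : Matrix (Fin 3) (Fin 3) ℤ) (c : Fin 3 → ℤ)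
    (N : Matrix (Fin 3) (Fin 3) ℤ) (d : Fin 3 → ℤ) (hNM : N * M = 1) (hd : N.mulVec c + d = 0)
    (hs : s.image (fun v => M.mulVec v + c) = s') : LatticeEquivalent P (latticeHull s') := by
  let χ := (intAffine M c).comp φ
  have himage : χ '' P = latticeHull s' := by
    rw [← hs, ← image_latticeHull, ← h.image_eq, AffineMap.coe_comp, image_comp]
  have hlat : ∀ x ∈ (affineSpan ℝ P : Set (Fin n → ℝ)) ∩ lattice (Fin n),
      χ x ∈ lattice (Fin 3) := by
    intro x hx
    obtain ⟨v, hv⟩ := exists_castVec_eq (h.mem_lattice x hx)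
    change intAffine M c (φ x) ∈ _
    rw [← hv, intAffine_castVec]
    exact castVec_mem_lattice _
  have hsurj : {w : Fin 3 → ℤ |
      castVec w ∈ χ '' ((affineSpan ℝ P : Set (Fin n → ℝ)) ∩ lattice (Fin n))} = Set.univ := by
    apply hspan
    · rintro u ⟨x, ⟨hx, hxl⟩, hu⟩ v ⟨y, ⟨hy, hyl⟩, hv⟩ w ⟨z, ⟨hz, hzl⟩, hw⟩ k
      refine ⟨(k : ℝ) • (y - z) + x, ⟨?_, fun i => ?_⟩, ?_⟩
      · rw [SetLike.mem_coe, ← vadd_eq_add]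
        refine AffineSubspace.vadd_mem_of_mem_direction (Submodule.smul_mem _ _ ?_) hx
        exact AffineSubspace.vsub_mem_direction hy hz
      · obtain ⟨a, ha⟩ := hxl i
        obtain ⟨b, hb⟩ := hyl i
        obtain ⟨e, he⟩ := hzl i
        exact ⟨k * (b - e) + a, by simp [ha, hb, he]⟩
      · rw [← vadd_eq_add, AffineMap.map_vadd, map_smul, ← vsub_eq_sub, AffineMap.linearMap_vsub,
          hu, hv, hw]
        ext i
        simp [castVec]
        ring
    · intro w hw
      rw [← hs, Finset.coe_image] at hw
      obtain ⟨v, hv, rfl⟩ := hw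
      obtain ⟨x, hx, hxv⟩ := h.exists_lift v hv
      refine ⟨x, hx, ?_⟩
      change intAffine M c (φ x) = _
      rw [hxv, intAffine_castVec]
  refine ⟨χ, ?_, ?_, himage⟩
  · exact (intAffine_leftInverse hNM hd).injective.injOn.comp h.injOn (mapsTo_univ _ _)
  · rw [← himage, ← AffineSubspace.map_span, AffineSubspace.coe_map]
    ext y
    constructor
    · rintro ⟨x, hx, rfl⟩
      exact ⟨⟨x, hx.1, rfl⟩, hlat x hx⟩
    · rintro ⟨-, hy⟩
      obtain ⟨w, rfl⟩ := exists_castVec_eq hy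
      have : w ∈ Set.univ := trivial
      rwa [← hsurj] at this

/-- The vertices of the product of a segment and a triangle. -/
def prismPoints : Fin 6 → Fin 3 → ℤ :=
  ![![0, 0, 0], ![1, 0, 0], ![0, 1, 0], ![1, 1, 0], ![0, 0, 1], ![1, 0, 1]]

theorem spans_Ia : SpansLattice (Finset.univ.image intPointsIa) :=
  spansLattice_of_frame (by decide) (by decide) (by decide) (by decide)

theorem spans_IIc : SpansLattice (Finset.univ.image intPointsIIc) :=
  spansLattice_of_frame (by decide) (by decide) (by decide) (by decide)

theorem spans_Ib : SpansLattice (Finset.univ.image intPointsIb) :=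
  spansLattice_of_frame (by decide) (by decide) (by decide) (by decide)

theorem spans_prism : SpansLattice (Finset.univ.image prismPoints) :=
  spansLattice_of_frame (by decide) (by decide) (by decide) (by decide)

theorem spans_cube : SpansLattice (Finset.univ.image cubeVertex) :=
  spansLattice_of_frame (by decide) (by decide) (by decide) (by decide)

/-- The fifteen sets comprise one simplex, six pyramids, four octahedra, three prisms and the cube.
-/
theorem IsCubeChart.classification (h : IsCubeChart P φ s) :
    LatticeEquivalent P (latticeHull (Finset.univ.image intPointsIa)) ∨
    LatticeEquivalent P (latticeHull (Finset.univ.image intPointsIIc)) ∨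
    LatticeEquivalent P (latticeHull (Finset.univ.image intPointsIb)) ∨
    LatticeEquivalent P (latticeHull (Finset.univ.image prismPoints)) ∨
    LatticeEquivalent P (latticeHull (Finset.univ.image cubeVertex)) := by
  obtain ⟨B, hB⟩ : ∃ B : Fin 8 → Bool, ∀ j, B j = true ↔ cubeVertex j ∈ s :=
    ⟨fun j => decide (cubeVertex j ∈ s), fun j => decide_eq_true_iff⟩
  have hs : s = (Finset.univ.filter fun j => B j = true).image cubeVertex := by
    ext v
    simp only [Finset.mem_image, Finset.mem_filter, Finset.mem_univ, true_and, hB]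
    constructor
    · intro hv
      obtain ⟨j, rfl⟩ := exists_cubeVertex_eq (h.zero_or_one v hv)
      exact ⟨j, hv, rfl⟩
    · rintro ⟨j, hj, rfl⟩
      exact hj
  have hc : ∀ (i : Fin 3) (a b : Fin 8), a ≠ b → cubeVertex a i = 0 → cubeVertex b i = 0 →
      B a = true ∨ B b = true := fun i a b hab ha hb => by
    rw [hB, hB]
    exact h.mem_or_mem i a b hab ha hb
  have hcases : [B 0, B 1, B 2, B 3, B 4, B 5, B 6, B 7] ∈ _ :=
    cube_cases (B 0) (B 1) (B 2) (B 3) (B 4) (B 5) (B 6) (B 7) (by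
      simp only [List.all_cons, List.all_nil, id_eq, Bool.and_true, Bool.and_eq_true,
        Bool.or_eq_true, Bool.not_eq_true', ← Bool.not_eq_true, ← imp_iff_not_or, and_imp]
      refine ⟨hc 1 0 1 (by decide) rfl rfl, hc 0 0 2 (by decide) rfl rfl,
        hc 2 0 3 (by decide) rfl rfl,
        hc 0 0 4 (by decide) rfl rfl, hc 1 0 5 (by decide) rfl rfl, hc 0 0 6 (by decide) rfl rfl,
        hc 2 1 2 (by decide) rfl rfl, hc 2 1 3 (by decide) rfl rfl, hc 1 1 4 (by decide) rfl rfl,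
        hc 1 1 5 (by decide) rfl rfl, hc 2 2 3 (by decide) rfl rfl, hc 0 2 4 (by decide) rfl rfl,
        hc 0 2 6 (by decide) rfl rfl, hc 1 4 5 (by decide) rfl rfl, hc 0 4 6 (by decide) rfl rfl,
        ?_, ?_, ?_, ?_, ?_, ?_, ?_, ?_⟩ <;> simp only [hB]
      · exact fun h0 h1 h2 h4 h7 => (h.mem_of_tripod h0 h1 h2 h4 h7).1
      · exact fun h0 h1 h2 h4 h7 => (h.mem_of_tripod h0 h1 h2 h4 h7).2.1
      · exact fun h0 h1 h2 h4 h7 => (h.mem_of_tripod h0 h1 h2 h4 h7).2.2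
      · exact h.mem_seven
      · exact fun h1 h2 h3 h4 h5 _ h7 => h.mem_zero h1 h2 h3 h4 h5 h7
      · exact fun h0 h1 h2 h3 h5 h6 => h.mem_of_prism (by decide) h0 h1 h2 h3 h5 h6
      · exact fun h0 h1 h4 h5 h3 h6 => h.mem_of_prism (by decide) h0 h1 h4 h3 h5 h6
      · exact fun h0 h2 h4 h6 h3 h5 => h.mem_of_prism (by decide) h0 h2 h4 h3 h5 h6)
  have hBvec : B = ![B 0, B 1, B 2, B 3, B 4, B 5, B 6, B 7] := by
    ext j; fin_cases j <;> rfl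
  clear hB hc
  generalize B 0 = b₀, B 1 = b₁, B 2 = b₂, B 3 = b₃, B 4 = b₄, B 5 = b₅, B 6 = b₆, B 7 = b₇
    at hcases hBvec
  subst hBvec
  simp only [List.mem_cons, List.not_mem_nil, or_false, List.cons.injEq, and_true] at hcases
  rcases hcases with ⟨rfl, rfl, rfl, rfl, rfl, rfl, rfl, rfl⟩ |
     ⟨rfl, rfl, rfl, rfl, rfl, rfl, rfl, rfl⟩ |
     ⟨rfl, rfl, rfl, rfl, rfl, rfl, rfl, rfl⟩ |
     ⟨rfl, rfl, rfl, rfl, rfl, rfl, rfl, rfl⟩ |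
     ⟨rfl, rfl, rfl, rfl, rfl, rfl, rfl, rfl⟩ |
     ⟨rfl, rfl, rfl, rfl, rfl, rfl, rfl, rfl⟩ |
     ⟨rfl, rfl, rfl, rfl, rfl, rfl, rfl, rfl⟩ |
     ⟨rfl, rfl, rfl, rfl, rfl, rfl, rfl, rfl⟩ |
     ⟨rfl, rfl, rfl, rfl, rfl, rfl, rfl, rfl⟩ |
     ⟨rfl, rfl, rfl, rfl, rfl, rfl, rfl, rfl⟩ |
     ⟨rfl, rfl, rfl, rfl, rfl, rfl, rfl, rfl⟩ |
     ⟨rfl, rfl, rfl, rfl, rfl, rfl, rfl, rfl⟩ |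
     ⟨rfl, rfl, rfl, rfl, rfl, rfl, rfl, rfl⟩ |
     ⟨rfl, rfl, rfl, rfl, rfl, rfl, rfl, rfl⟩ |
     ⟨rfl, rfl, rfl, rfl, rfl, rfl, rfl, rfl⟩
  -- In every case `(M, c)` is a unimodular affine map onto the vertices of the model, followed by
  -- its inverse `(N, d)`.
  · exact Or.inr (Or.inr (Or.inl (h.latticeEquivalent spans_Ib
      !![0, 0, 1; 0, 1, 0; -1, 0, 0] ![0, 0, 1]
      !![0, 0, -1; 0, 1, 0; 1, 0, 0] ![1, 0, 0]
      (by decide) (by decide) (by rw [hs]; decide))))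
  · exact Or.inr (Or.inl (h.latticeEquivalent spans_IIc
      !![0, 0, 1; 0, -1, -1; 1, 0, 0] ![0, 1, 0]
      !![0, 0, 1; -1, -1, 0; 1, 0, 0] ![0, 1, 0]
      (by decide) (by decide) (by rw [hs]; decide)))
  · exact Or.inr (Or.inr (Or.inl (h.latticeEquivalent spans_Ib
      !![0, 0, 1; 0, 1, 0; 1, 0, 0] ![0, 0, 0]
      !![0, 0, 1; 0, 1, 0; 1, 0, 0] ![0, 0, 0]
      (by decide) (by decide) (by rw [hs]; decide))))
  · exact Or.inr (Or.inl (h.latticeEquivalent spans_IIc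
      !![0, 0, 1; -1, 0, -1; 0, 1, 0] ![0, 1, 0]
      !![-1, -1, 0; 0, 0, 1; 1, 0, 0] ![1, 0, 0]
      (by decide) (by decide) (by rw [hs]; decide)))
  · exact Or.inr (Or.inr (Or.inl (h.latticeEquivalent spans_Ib
      !![0, 0, 1; 1, 0, 0; 0, 1, 0] ![0, 0, 0]
      !![0, 1, 0; 0, 0, 1; 1, 0, 0] ![0, 0, 0]
      (by decide) (by decide) (by rw [hs]; decide))))
  · exact Or.inr (Or.inl (h.latticeEquivalent spans_IIc
      !![0, 0, 1; -1, -1, 0; 0, 1, 0] ![0, 1, 0]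
      !![0, -1, -1; 0, 0, 1; 1, 0, 0] ![1, 0, 0]
      (by decide) (by decide) (by rw [hs]; decide)))
  · exact Or.inr (Or.inr (Or.inl (h.latticeEquivalent spans_Ib
      !![0, 1, 0; 1, 0, 0; 0, 0, 1] ![0, 0, 0]
      !![0, 1, 0; 1, 0, 0; 0, 0, 1] ![0, 0, 0]
      (by decide) (by decide) (by rw [hs]; decide))))
  · exact Or.inl (h.latticeEquivalent spans_Ia
      !![0, 0, 1; 0, 1, 0; 1, 0, 0] ![0, 0, 0]
      !![0, 0, 1; 0, 1, 0; 1, 0, 0] ![0, 0, 0]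
      (by decide) (by decide) (by rw [hs]; decide))
  · exact Or.inr (Or.inl (h.latticeEquivalent spans_IIc
      !![0, 0, 1; 1, 0, 0; 0, 1, 0] ![0, 0, 0]
      !![0, 1, 0; 0, 0, 1; 1, 0, 0] ![0, 0, 0]
      (by decide) (by decide) (by rw [hs]; decide)))
  · exact Or.inr (Or.inl (h.latticeEquivalent spans_IIc
      !![0, 0, 1; 0, 1, 0; 1, 0, 0] ![0, 0, 0]
      !![0, 0, 1; 0, 1, 0; 1, 0, 0] ![0, 0, 0]
      (by decide) (by decide) (by rw [hs]; decide)))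
  · exact Or.inr (Or.inr (Or.inr (Or.inl (h.latticeEquivalent spans_prism
      !![0, 0, 1; 0, 1, 0; 1, 0, 0] ![0, 0, 0]
      !![0, 0, 1; 0, 1, 0; 1, 0, 0] ![0, 0, 0]
      (by decide) (by decide) (by rw [hs]; decide)))))
  · exact Or.inr (Or.inl (h.latticeEquivalent spans_IIc
      !![0, 1, 0; 0, 0, 1; 1, 0, 0] ![0, 0, 0]
      !![0, 0, 1; 1, 0, 0; 0, 1, 0] ![0, 0, 0]
      (by decide) (by decide) (by rw [hs]; decide)))
  · exact Or.inr (Or.inr (Or.inr (Or.inl (h.latticeEquivalent spans_prism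
      !![0, 1, 0; 0, 0, 1; 1, 0, 0] ![0, 0, 0]
      !![0, 0, 1; 1, 0, 0; 0, 1, 0] ![0, 0, 0]
      (by decide) (by decide) (by rw [hs]; decide)))))
  · exact Or.inr (Or.inr (Or.inr (Or.inl (h.latticeEquivalent spans_prism
      !![1, 0, 0; 0, 0, 1; 0, 1, 0] ![0, 0, 0]
      !![1, 0, 0; 0, 0, 1; 0, 1, 0] ![0, 0, 0]
      (by decide) (by decide) (by rw [hs]; decide)))))
  · exact Or.inr (Or.inr (Or.inr (Or.inr (h.latticeEquivalent spans_cube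
      !![0, 0, 1; 0, 1, 0; 1, 0, 0] ![0, 0, 0]
      !![0, 0, 1; 0, 1, 0; 1, 0, 0] ![0, 0, 0]
      (by decide) (by decide) (by rw [hs]; decide)))))

end

/-! ### The prism and the cube are products -/

theorem polyProd_latticeHull {m n : Type*} [DecidableEq m] [DecidableEq n] [Fintype m] [Fintype n]
    (A : Finset (m → ℤ)) (B : Finset (n → ℤ)) :
    polyProd (latticeHull A) (latticeHull B) =
      latticeHull ((A ×ˢ B).image fun p => (Sum.elim p.1 p.2 : m ⊕ n → ℤ)) := by
  unfold latticeHull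
  rw [← convexHull_polyProd]
  congr 1
  ext x
  constructor
  · rintro ⟨⟨a, ha, hax⟩, b, hb, hbx⟩
    refine ⟨Sum.elim a b, ?_, ?_⟩
    · simp only [Finset.coe_image, mem_image, Finset.mem_coe, Finset.mem_product]
      exact ⟨(a, b), ⟨ha, hb⟩, rfl⟩
    · ext (i | k)
      · exact congrFun hax i
      · exact congrFun hbx k
  · rintro ⟨v, hv, rfl⟩
    simp only [Finset.coe_image, mem_image, Finset.mem_coe, Finset.mem_product] at hv
    obtain ⟨⟨a, b⟩, ⟨ha, hb⟩, rfl⟩ := hv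
    exact ⟨⟨a, ha, rfl⟩, b, hb, rfl⟩

theorem affineSpan_latticeHull_eq_top {s : Finset (Fin 3 → ℤ)} (h0 : ![0, 0, 0] ∈ s)
    (h1 : ![1, 0, 0] ∈ s) (h2 : ![0, 1, 0] ∈ s) (h3 : ![0, 0, 1] ∈ s) :
    affineSpan ℝ (latticeHull s) = ⊤ := by
  have hmem : ∀ v ∈ s, castVec v ∈ latticeHull s := fun v hv =>
    subset_convexHull ℝ _ (mem_image_of_mem _ hv)
  refine affineSpan_eq_top_of_frame (hmem _ h0) (hmem _ h1) (hmem _ h2) (hmem _ h3)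
    fun x => ⟨x 0, x 1, x 2, ?_⟩
  ext j; fin_cases j <;> simp [castVec]

theorem polyDim_le {n : ℕ} (P : Set (Fin n → ℝ)) : polyDim P ≤ n :=
  (Submodule.finrank_le _).trans_eq (Module.finrank_fin_fun ℝ)

/-- The isomorphism `ℤ^3 → ℤ^1 × ℤ^2`. -/
def splitMatrix : Matrix (Fin 1 ⊕ Fin 2) (Fin 3) ℤ :=
  Matrix.of (Sum.elim ![![1, 0, 0]] ![![0, 1, 0], ![0, 0, 1]])

/-- Splitting off the first coordinate exhibits the product; the factors live in dimensions 1 and 2,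
both below 3. -/
theorem not_isPrimePolytope_of_product {n : ℕ} {P : Set (Fin n → ℝ)} (hd : polyDim P = 3)
    {s : Finset (Fin 3 → ℤ)} (h0 : ![0, 0, 0] ∈ s) (h1 : ![1, 0, 0] ∈ s) (h2 : ![0, 1, 0] ∈ s)
    (h3 : ![0, 0, 1] ∈ s) (A : Finset (Fin 1 → ℤ)) (B : Finset (Fin 2 → ℤ))
    (hs : (s.image fun v => splitMatrix.mulVec v + 0) =
      (A ×ˢ B).image fun p => (Sum.elim p.1 p.2 : Fin 1 ⊕ Fin 2 → ℤ))
    (h : LatticeEquivalent P (latticeHull s)) : ¬ IsPrimePolytope P := by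
  rintro ⟨-, -, hprime⟩
  refine hprime ⟨1, 2, latticeHull A, latticeHull B, isLatticePolytope_latticeHull A,
    isLatticePolytope_latticeHull B, ?_, ?_, h.trans ⟨intAffine splitMatrix 0, ?_⟩⟩
  · exact (polyDim_le _).trans_lt (by omega)
  · exact (polyDim_le _).trans_lt (by omega)
  · rw [polyProd_latticeHull, ← hs, ← image_latticeHull]
    exact isLatticeEquivalence_intAffine (N := splitMatrix.transpose) (c := 0) (by decide)
      (by decide) (affineSpan_latticeHull_eq_top h0 h1 h2 h3)

theorem latticeHull_eq_convexHull_range {k : ℕ} {n : Type*} [DecidableEq n] [Fintype n]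
    {p : Fin k → n → ℤ} {q : Fin k → n → ℝ} (h : ∀ i, castVec (p i) = q i) :
    latticeHull (Finset.univ.image p) = convexHull ℝ (Set.range q) := by
  unfold latticeHull
  rw [Finset.coe_image, Finset.coe_univ, image_univ, ← range_comp]
  congr 2
  exact funext h

/-! ### Completeness of the list -/

theorem latticeEquivalent_of_isPrimeCompressedFlow3 {n : ℕ} {P : Set (Fin n → ℝ)}
    (hP : IsPrimeCompressedFlow3 P) :
    LatticeEquivalent P nablaIa ∨ LatticeEquivalent P nablaIIc ∨ LatticeEquivalent P nablaIb := by
  obtain ⟨hf, hp, hc, hd⟩ := hP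
  obtain ⟨φ, s, hs⟩ := exists_cubeChart hf hc hd
  rw [nablaIa_eq_convexHull, nablaIIc_eq_convexHull, nablaIb_eq_convexHull,
    ← latticeHull_eq_convexHull_range castVec_intPointsIa,
    ← latticeHull_eq_convexHull_range castVec_intPointsIIc,
    ← latticeHull_eq_convexHull_range castVec_intPointsIb]
  rcases hs.classification with h | h | h | h | h
  · exact Or.inl h
  · exact Or.inr (Or.inl h)
  · exact Or.inr (Or.inr h)
  -- The prism is a segment times a triangle, the cube a segment times a square.
  · exact absurd hp (not_isPrimePolytope_of_product hd (by decide) (by decide) (by decide)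
      (by decide) {![0], ![1]} {![0, 0], ![1, 0], ![0, 1]} (by decide) h)
  · exact absurd hp (not_isPrimePolytope_of_product hd (by decide) (by decide) (by decide)
      (by decide) {![0], ![1]} {![0, 0], ![1, 0], ![0, 1], ![1, 1]} (by decide) h)

end FlowPolytope

theorem mainTheorem5 :
    -- each of the three is a prime compressed three-dimensional flow polytope
    (IsPrimeCompressedFlow3 nablaIa ∧ IsPrimeCompressedFlow3 nablaIIc ∧
      IsPrimeCompressedFlow3 nablaIb) ∧
    -- they are pairwise inequivalent
    (¬ LatticeEquivalent nablaIa nablaIIc ∧ ¬ LatticeEquivalent nablaIa nablaIb ∧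
      ¬ LatticeEquivalent nablaIIc nablaIb) ∧
    -- there are no others
    (∀ (n : ℕ) (P : Set (Fin n → ℝ)), IsPrimeCompressedFlow3 P →
      LatticeEquivalent P nablaIa ∨ LatticeEquivalent P nablaIIc ∨
        LatticeEquivalent P nablaIb) ∧
    -- the (quiver, weight) pairs are tight
    (quiverIa.IsTight weightIa ∧ quiverIIc.IsTight weightIIc ∧ quiverIb.IsTight weightIb) ∧
    -- the arrow labels give equivalences with the polytopes of the (quiver, weight) pairs
    ((∃ f : (Fin 3 → ℝ) →ᵃ[ℝ] (Fin 4 → ℝ), (∀ p, f p = labelIa p) ∧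
        IsLatticeEquivalence f nablaIa (quiverIa.nabla weightIa)) ∧
      (∃ f : (Fin 3 → ℝ) →ᵃ[ℝ] (Fin 5 → ℝ), (∀ p, f p = labelIIc p) ∧
        IsLatticeEquivalence f nablaIIc (quiverIIc.nabla weightIIc)) ∧
      (∃ f : (Fin 3 → ℝ) →ᵃ[ℝ] (Fin 8 → ℝ), (∀ p, f p = labelIb p) ∧
        IsLatticeEquivalence f nablaIb (quiverIb.nabla weightIb))) ∧
    -- the lattice points, listed without repetition
    ((Function.Injective pointsIa ∧ Set.range pointsIa = nablaIa ∩ lattice (Fin 3)) ∧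
      (Function.Injective pointsIIc ∧ Set.range pointsIIc = nablaIIc ∩ lattice (Fin 3)) ∧
      (Function.Injective pointsIb ∧ Set.range pointsIb = nablaIb ∩ lattice (Fin 3))) ∧
    -- the first polytope is the unimodular simplex
    nablaIa = convexHull ℝ (Set.range pointsIa) := by
  refine ⟨⟨isPrimeCompressedFlow3_nablaIa, isPrimeCompressedFlow3_nablaIIc,
      isPrimeCompressedFlow3_nablaIb⟩, ⟨?_, ?_, ?_⟩,
    fun n P hP => latticeEquivalent_of_isPrimeCompressedFlow3 hP,
    ⟨isTight_Ia, isTight_IIc, isTight_Ib⟩,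
    ⟨⟨_, intAffine_Ia, isLatticeEquivalence_labelIa⟩,
      ⟨_, intAffine_IIc, isLatticeEquivalence_labelIIc⟩,
      ⟨_, intAffine_Ib, isLatticeEquivalence_labelIb⟩⟩,
    ⟨⟨injective_pointsIa, range_pointsIa⟩, ⟨injective_pointsIIc, range_pointsIIc⟩,
      ⟨injective_pointsIb, range_pointsIb⟩⟩, nablaIa_eq_convexHull⟩
  all_goals
    intro h
    have := h.ncard_eq
    simp [ncard_Ia, ncard_IIc, ncard_Ib] at this
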